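/- Let $N_0,N_1$ be positive integers, $\psi_0$ a real, primitive, even Dirichlet character modulo $N_0$ and $\psi_1$ a real, primitive, odd Dirichlet character modulo $N_1$. For $z\in\mathbb H$ and $q=e^{2\pi i z}$ put $$\theta_0(z)=\sum_{n\ge 0}\psi_0(n)q^{n^2},\qquad \theta_1(z)=\sum_{n\ge 1}n\,\psi_1(n)q^{n^2},$$ where $\psi_0(0)$ is read as $1/2$ in the first series if $\psi_0$ is trivial. Assume that $\theta_0$ and $\theta_1$ have no zeros in $\mathbb H$. Let $a\in\mathbb Z$ and let $k\in\frac12+\mathbb Z$ with $k-\frac32\in\mathbb Z_{\ge 0}$. For a smooth ($C^\infty$ in the real sense) function $f:\mathbb H\to\mathbb C$ put $$\delta_a^{k-1}(f)=\theta_0^{3a-2}\,\theta_1^{1-a}\,D^{k-\frac32}\bigl(\theta_0^{1-3a}\,\theta_1^{a}\,f\bigr),\qquad D^{m}=(2\pi i)^{-m}\frac{d^m}{dz^m},$$ where $\frac{d}{dz}=\frac12\bigl(\frac{\partial}{\partial x}-i\frac{\partial}{\partial y}\bigr)$. All complex powers are taken with $-\pi<\arg\le\pi$. For an odd integer $d$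 let $\epsilon_d=1$ if $d\equiv1\bmod 4$ and $\epsilon_d=i$ if $d\equiv 3\bmod 4$, and let $\left(\frac{c}{d}\right)$ be the Kronecker symbol. For $\kappa\in\frac12+\mathbb Z$, $4\mid N$, $\gamma=\left(\begin{smallmatrix} *&*\\ c&d\end{smallmatrix}\right)\in\Gamma_0(N)$ and $W_M=\left(\begin{smallmatrix}0&-1/\sqrt M\\ \sqrt M&0\end{smallmatrix}\right)$ with $M\ge1$ put $$(f|_\kappa\gamma)(z)=\left(\frac cd\right)\epsilon_d^{2\kappa}(cz+d)^{-\kappa}f(\gamma z),\qquad (f|_\kappa W_M)(z)=f(W_Mz)\,(\sqrt M z)^{-\kappa}.$$ Let $N=\operatorname{lcm}(4N_0^2,4N_1^2)$. Then for every smooth $f:\mathbb H\to\mathbb C$: (1) For every $\gamma=\left(\begin{smallmatrix} *&*\\ c&d\end{smallmatrix}\right)\in\Gamma_0(N)$ one has $\psi_1(d)\ne0$ and $$\delta_a^{k-1}(f|_{2-k}\gamma)=\left(\frac{-1}{d}\right)\frac{\psi_0(d)}{\psi_1(d)}\;\delta_a^{k-1}(f)|_k\gamma .$$ (2) If $N_0=N_1$,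 then $N=4N_0^2$, $\tau(\psi_1)\neq 0$ and $$\delta_a^{k-1}(f|_{2-k}W_N)=-\frac{\tau(\psi_0)}{\tau(\psi_1)}\;\delta_a^{k-1}(f)|_kW_N,$$ where $\tau(\psi_i)=\sum_{u\bmod N_i}\psi_i(u)e^{2\pi i u/N_i}$. -/

import Mathlib

open scoped UpperHalfPlane MatrixGroups ContDiff

namespace HalfBol

noncomputable section

/-- The Kronecker symbol `(c / d)` for odd `d` (positive or negative): the Jacobi symbol
`(c / |d|)`, times `-1` when `c` and `d` are both negative. In particular `(0 / ±1) = 1`. -/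
def kroneckerSym (c d : ℤ) : ℤ :=
  (if c < 0 ∧ d < 0 then -1 else 1) * jacobiSym c d.natAbs

/-- `ε_d` for odd `d`: it is `1` if `d ≡ 1 mod 4` and `i` if `d ≡ 3 mod 4`. -/
def epsilon (d : ℤ) : ℂ := if d % 4 = 1 then 1 else Complex.I

/-- The slash action `f |_k γ` in half-integral weight `k`, for `γ ∈ Γ₀(N)` with `4 ∣ N`
(so that `d` is odd). All powers are principal branches. -/
def slashHalf (k : ℝ) (f : ℍ → ℂ) (γ : SL(2, ℤ)) (z : ℍ) : ℂ :=
  (kroneckerSym (γ 1 0) (γ 1 1) : ℂ) * epsilon (γ 1 1) ^ (2 * (k : ℂ)) *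
    ((γ 1 0 : ℂ) * (z : ℂ) + (γ 1 1 : ℂ)) ^ (-(k : ℂ)) * f (γ • z)

/-- The Fricke matrix `W_M`, with rows `(0, -1/√M)` and `(√M, 0)`. -/
def frickeMatrix (M : ℕ) [NeZero M] : SL(2, ℝ) :=
  ⟨!![0, -(√(M : ℝ))⁻¹; √(M : ℝ), 0], by
    have h : √(M : ℝ) ≠ 0 :=
      (Real.sqrt_pos.mpr (Nat.cast_pos.mpr (Nat.pos_of_ne_zero (NeZero.ne M)))).ne'
    simp [Matrix.det_fin_two, h]⟩

/-- `(f |_k W_M)(z) = f(W_M z) (√M z)^{-k}`, with the principal branch of the power. -/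
def slashFricke (k : ℝ) (f : ℍ → ℂ) (M : ℕ) [NeZero M] (z : ℍ) : ℂ :=
  f (frickeMatrix M • z) * ((√(M : ℝ) : ℂ) * (z : ℂ)) ^ (-(k : ℂ))

open Classical in
/-- `θ₀(z) = ∑_{n ≥ 0} ψ(n) q^{n²}` with `q = e^{2πiz}`, where `ψ(0)` is read as `1/2`
if `ψ` is trivial. -/
def theta0 {N : ℕ} (ψ : DirichletCharacter ℂ N) (z : ℍ) : ℂ :=
  ∑' n : ℕ, (if n = 0 ∧ ψ = 1 then 1 / 2 else ψ (n : ZMod N)) *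
    Complex.exp (2 * Real.pi * Complex.I * (n : ℂ) ^ 2 * (z : ℂ))

/-- `θ₁(z) = ∑_{n ≥ 1} n ψ(n) q^{n²}` with `q = e^{2πiz}` (the term of `n = 0` vanishes). -/
def theta1 {N : ℕ} (ψ : DirichletCharacter ℂ N) (z : ℍ) : ℂ :=
  ∑' n : ℕ, (n : ℂ) * ψ (n : ZMod N) *
    Complex.exp (2 * Real.pi * Complex.I * (n : ℂ) ^ 2 * (z : ℂ))

/-- The Dirichlet character takes real values only. -/
def IsRealChar {N : ℕ} (ψ : DirichletCharacter ℂ N) : Prop := ∀ n : ZMod N, (ψ n).im = 0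

/-- The Gauss sum `τ(ψ) = ∑_{u mod N} ψ(u) e^{2πiu/N}`. -/
def tau {N : ℕ} [NeZero N] (ψ : DirichletCharacter ℂ N) : ℂ := gaussSum ψ ZMod.stdAddChar

/-- Smooth (`C^∞` in the real sense) complex functions on the upper half-plane. -/
def IsSmooth (f : ℍ → ℂ) : Prop :=
  ContDiffOn ℝ ∞ (fun w : ℂ => f (UpperHalfPlane.ofComplex w)) {w : ℂ | 0 < w.im}

/-- The operator `d/dz = (∂/∂x - i ∂/∂y) / 2` on functions on the upper half-plane; on holomorphic
functions it is the complex derivative. -/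
def ddz (f : ℍ → ℂ) (z : ℍ) : ℂ :=
  (fderiv ℝ (fun w : ℂ => f (UpperHalfPlane.ofComplex w)) (z : ℂ) 1 -
    Complex.I *
      fderiv ℝ (fun w : ℂ => f (UpperHalfPlane.ofComplex w)) (z : ℂ) Complex.I) / 2

/-- The Bol operator `D^m = (2πi)^{-m} d^m/dz^m`. -/
def bolD (m : ℕ) (f : ℍ → ℂ) (z : ℍ) : ℂ :=
  ((2 * Real.pi * Complex.I) ^ m)⁻¹ * (ddz^[m] f) z

/-- The operator `δ_a^{k-1}(f) = θ₀^{3a-2} θ₁^{1-a} D^{k-3/2}(θ₀^{1-3a} θ₁^a f)`, where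
`m = k - 3/2`. -/
def delta {N₀ N₁ : ℕ} (ψ₀ : DirichletCharacter ℂ N₀) (ψ₁ : DirichletCharacter ℂ N₁)
    (m : ℕ) (a : ℤ) (f : ℍ → ℂ) (z : ℍ) : ℂ :=
  theta0 ψ₀ z ^ (3 * a - 2) * theta1 ψ₁ z ^ (1 - a) *
    bolD m (fun w => theta0 ψ₀ w ^ (1 - 3 * a) * theta1 ψ₁ w ^ a * f w) z

end

end HalfBol

namespace HalfBol

noncomputable section

/-! The operator is Bol's identity conjugated by theta functions. The derivative `D^m` carries
weight `1 - m` to weight `1 + m`, and this survives for functions that are only real-smooth, because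
`d/dz` obeys the holomorphic chain rule under Möbius maps. With `θ₀` of weight 1/2 and `θ₁` of
weight 3/2, the product `θ₀^(1-3a) θ₁^a` has weight 1/2 for every `a`. With `f` in weight `2 - k` it
gives weight `5/2 - k = 1 - m`; after `D^m` the outer factor `θ₀^(3a-2) θ₁^(1-a)`, again of weight
1/2, leads to weight `k`. If `θ₀` and `θ₁` transform with constants `A₀` and `A₁`, all powers
depending on `a` cancel and the constant left over is `A₀ / A₁` (`delta_slash`).

It remains to find the constants. The law of `jacobiTheta₂ w (2z)` under integral matrices with `4 ∣
c` (`thetaLaw_of_four_dvd`) follows by a Euclidean descent through the generators `(1 1; 0 1)` and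
`(1 0; 4 1)`; the signs of principal square roots match those of the Kronecker symbol. Evaluated at
the division points `u / N`, for `4N² ∣ c`, it permutes them by `u ↦ du`; its derivative in `w` does
the same in weight 3/2. Gauss sums write `θ₀` and `θ₁` as character sums over these points, so both
acquire `ψ(d)` times the same multiplier `(c / d) ε_d⁻¹`, which cancels in `A₀ / A₁`. The factor
`(-1 / d)` comes from comparing `ε_d^(2(2-k))` with `ε_d^(2k)`.

For `W_N` the functional equation of `jacobiTheta₂` gives `A₀ / A₁ = τ(ψ₁) / τ(ψ₀)`. Since the
thetas do not vanish at the fixed point of `W_N`, `τ(ψ₁)² = -τ(ψ₀)²` (via `theta_fricke_const_sq`),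
and the ratio equals `-τ(ψ₀) / τ(ψ₁)`. -/

/-! ### Calculus of `d/dz` on smooth functions -/

theorem ofComplex_eventuallyEq {f : ℍ → ℂ} {F : ℂ → ℂ} (h : ∀ z : ℍ, f z = F z) (z : ℍ) :
    (fun w : ℂ => f (UpperHalfPlane.ofComplex w)) =ᶠ[nhds (z : ℂ)] F := by
  filter_upwards [UpperHalfPlane.isOpen_upperHalfPlaneSet.mem_nhds z.im_pos] with w hw
  rw [h, UpperHalfPlane.ofComplex_apply_of_im_pos hw]

theorem isOpen_im_pos : IsOpen {w : ℂ | 0 < w.im} := isOpen_lt continuous_const Complex.continuous_im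

theorem IsSmooth.contDiffAt {f : ℍ → ℂ} (hf : IsSmooth f) (z : ℍ) :
    ContDiffAt ℝ ∞ (fun w : ℂ => f (UpperHalfPlane.ofComplex w)) (z : ℂ) :=
  ContDiffOn.contDiffAt hf (isOpen_im_pos.mem_nhds z.im_pos)

theorem isSmooth_of_contDiffAt {f : ℍ → ℂ}
    (hf : ∀ z : ℍ, ContDiffAt ℝ ∞ (fun w : ℂ => f (UpperHalfPlane.ofComplex w)) (z : ℂ)) :
    IsSmooth f := fun w hw => (hf ⟨w, hw⟩).contDiffWithinAt

theorem IsSmooth.differentiableAt {f : ℍ → ℂ} (hf : IsSmooth f) (z : ℍ) :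
    DifferentiableAt ℝ (fun w : ℂ => f (UpperHalfPlane.ofComplex w)) (z : ℂ) :=
  (hf.contDiffAt z).differentiableAt (by simp)

theorem IsSmooth.mul {f g : ℍ → ℂ} (hf : IsSmooth f) (hg : IsSmooth g) :
    IsSmooth (fun z => f z * g z) := ContDiffOn.mul hf hg

theorem IsSmooth.ddz {f : ℍ → ℂ} (hf : IsSmooth f) : IsSmooth (ddz f) := by
  have h : ContDiffOn ℝ ∞ (fderiv ℝ (fun w : ℂ => f (UpperHalfPlane.ofComplex w)))
      {w : ℂ | 0 < w.im} := hf.fderiv_of_isOpen isOpen_im_pos (by simp)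
  have h2 : ContDiffOn ℝ ∞ (fun w => (fderiv ℝ (fun w : ℂ => f (UpperHalfPlane.ofComplex w)) w 1 -
      Complex.I * fderiv ℝ (fun w : ℂ => f (UpperHalfPlane.ofComplex w)) w Complex.I) / 2)
      {w : ℂ | 0 < w.im} :=
    ((h.clm_apply contDiffOn_const).sub
      (contDiffOn_const.mul (h.clm_apply contDiffOn_const))).div_const 2
  refine h2.congr fun w hw => ?_
  simp only [HalfBol.ddz, UpperHalfPlane.ofComplex_apply_of_im_pos hw]

theorem IsSmooth.iterate_ddz {f : ℍ → ℂ} (hf : IsSmooth f) (n : ℕ) : IsSmooth (HalfBol.ddz^[n] f) := by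
  induction n with
  | zero => exact hf
  | succ n ih => rw [Function.iterate_succ_apply']; exact ih.ddz

/-- A function on the upper half-plane given by a holomorphic formula is smooth. -/
theorem isSmooth_of_differentiableOn {f : ℍ → ℂ} {F : ℂ → ℂ} (h : ∀ z : ℍ, f z = F z)
    (hF : DifferentiableOn ℂ F {w : ℂ | 0 < w.im}) : IsSmooth f := by
  have h1 : ContDiffOn ℂ ∞ F {w : ℂ | 0 < w.im} := hF.contDiffOn isOpen_im_pos
  refine (h1.restrict_scalars ℝ).congr fun w hw => ?_
  simp only [h, UpperHalfPlane.ofComplex_apply_of_im_pos hw]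

theorem ddz_mul {f g : ℍ → ℂ} (hf : IsSmooth f) (hg : IsSmooth g) (z : ℍ) :
    ddz (fun z => f z * g z) z = ddz f z * g z + f z * ddz g z := by
  unfold ddz
  rw [fderiv_fun_mul (hf.differentiableAt z) (hg.differentiableAt z)]
  simp only [_root_.add_apply, _root_.smul_apply, smul_eq_mul,
    UpperHalfPlane.ofComplex_apply]
  ring

theorem ddz_const_mul {f : ℍ → ℂ} (hf : IsSmooth f) (C : ℂ) (z : ℍ) :
    ddz (fun z => C * f z) z = C * ddz f z := by
  unfold ddz
  rw [fderiv_const_mul (hf.differentiableAt z)]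
  simp only [_root_.smul_apply, smul_eq_mul]
  ring

theorem ddz_add {f g : ℍ → ℂ} (hf : IsSmooth f) (hg : IsSmooth g) (z : ℍ) :
    ddz (fun z => f z + g z) z = ddz f z + ddz g z := by
  unfold ddz
  rw [fderiv_fun_add (hf.differentiableAt z) (hg.differentiableAt z)]
  simp only [_root_.add_apply]
  ring

theorem IsSmooth.const_mul {f : ℍ → ℂ} (hf : IsSmooth f) (C : ℂ) :
    IsSmooth (fun z => C * f z) := ContDiffOn.mul contDiffOn_const hf

theorem IsSmooth.add {f g : ℍ → ℂ} (hf : IsSmooth f) (hg : IsSmooth g) :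
    IsSmooth (fun z => f z + g z) := ContDiffOn.add hf hg

theorem IsSmooth.zpow {f : ℍ → ℂ} (hf : IsSmooth f) (h0 : ∀ z, f z ≠ 0) (n : ℤ) :
    IsSmooth (fun z => f z ^ n) := by
  refine isSmooth_of_contDiffAt fun z => ?_
  cases n with
  | ofNat n => simpa using (hf.contDiffAt z).pow n
  | negSucc n =>
    simp only [zpow_negSucc]
    exact ((hf.contDiffAt z).pow (n + 1)).inv (by simpa using h0 z)

theorem iterate_ddz_const_mul {f : ℍ → ℂ} (hf : IsSmooth f) (C : ℂ) (n : ℕ) :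
    ddz^[n] (fun z => C * f z) = fun z => C * ddz^[n] f z := by
  induction n with
  | zero => rfl
  | succ n ih =>
    rw [Function.iterate_succ_apply', ih, Function.iterate_succ_apply']
    ext z
    exact ddz_const_mul (hf.iterate_ddz n) C z

theorem bolD_const_mul {f : ℍ → ℂ} (hf : IsSmooth f) (C : ℂ) (n : ℕ) (z : ℍ) :
    bolD n (fun z => C * f z) z = C * bolD n f z := by
  simp only [bolD, iterate_ddz_const_mul hf]
  ring

/-- The real derivative of `Φ` is multiplication by `φ'`, so for any real-linear `A` the
conjugate-linear part drops out of `A φ' - i A (i φ')`. No holomorphy of `g` is needed. -/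
theorem ddz_comp {g : ℍ → ℂ} (hg : IsSmooth g) {φ : ℍ → ℍ} {Φ : ℂ → ℂ} {φ' : ℂ} {z : ℍ}
    (hφ : ∀ z : ℍ, (φ z : ℂ) = Φ z) (hΦ : HasDerivAt Φ φ' z) :
    ddz (fun z => g (φ z)) z = φ' * ddz g (φ z) := by
  have h1 : (fun w : ℂ => g (φ (UpperHalfPlane.ofComplex w))) =ᶠ[nhds (z : ℂ)]
      (fun w => (fun w : ℂ => g (UpperHalfPlane.ofComplex w)) (Φ w)) :=
    ofComplex_eventuallyEq (f := fun z => g (φ z)) (fun z => by simp [← hφ]) z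
  have h2 : HasFDerivAt (fun w : ℂ => g (UpperHalfPlane.ofComplex w))
      (fderiv ℝ (fun w : ℂ => g (UpperHalfPlane.ofComplex w)) (φ z)) (Φ z) := by
    rw [← hφ z]; exact (hg.differentiableAt (φ z)).hasFDerivAt
  have h3 := h2.comp (z : ℂ) (hΦ.hasFDerivAt.restrictScalars ℝ)
  unfold ddz
  rw [h1.fderiv_eq, show fderiv ℝ (fun w => (fun w : ℂ => g (UpperHalfPlane.ofComplex w)) (Φ w)) (z : ℂ)
    = _ from h3.fderiv]
  generalize fderiv ℝ (fun w : ℂ => g (UpperHalfPlane.ofComplex w)) (φ z) = A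
  have hA : ∀ x : ℂ, A x = x.re * A 1 + x.im * A Complex.I := fun x => by
    conv_lhs => rw [show x = x.re • (1 : ℂ) + x.im • Complex.I by simp [Complex.re_add_im]]
    rw [map_add, map_smul, map_smul]; simp
  simp only [ContinuousLinearMap.comp_apply, ContinuousLinearMap.coe_restrictScalars',
    ContinuousLinearMap.toSpanSingleton_apply, smul_eq_mul, one_mul]
  rw [hA φ', hA (Complex.I * φ')]
  conv_rhs => rw [← Complex.re_add_im φ']
  simp only [Complex.mul_re, Complex.mul_im, Complex.I_re, Complex.I_im]
  push_cast
  linear_combination ((φ'.im : ℂ) * A Complex.I / 2) * Complex.I_sq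

theorem ddz_of_hasDerivAt {f : ℍ → ℂ} {F : ℂ → ℂ} {F' : ℂ} {z : ℍ} (h : ∀ z : ℍ, f z = F z)
    (hF : HasDerivAt F F' z) : ddz f z = F' := by
  unfold ddz
  rw [(ofComplex_eventuallyEq h z).fderiv_eq, (hF.hasFDerivAt.restrictScalars ℝ).fderiv]
  simp only [ContinuousLinearMap.coe_restrictScalars',
    ContinuousLinearMap.toSpanSingleton_apply, smul_eq_mul, one_mul]
  linear_combination (-F' / 2) * Complex.I_sq

/-! ### Möbius maps and Bol's identity -/

/-- Leibniz' rule stops after two terms because the derivative of `J` is constant. In Bol's identity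
`J` is `c z + d`, and the second term cancels the derivative of the automorphy factor. -/
theorem iterate_ddz_linear_mul {J h : ℍ → ℂ} (hJ : IsSmooth J) (hh : IsSmooth h) {c : ℂ}
    (hc : ∀ z, ddz J z = c) (n : ℕ) :
    ddz^[n + 1] (fun z => J z * h z) =
      fun z => J z * ddz^[n + 1] h z + (n + 1) * c * ddz^[n] h z := by
  induction n with
  | zero =>
    ext z
    simp only [zero_add, Function.iterate_one, Function.iterate_zero, id, ddz_mul hJ hh, hc]
    push_cast; ring
  | succ n ih =>
    rw [Function.iterate_succ_apply', ih]
    ext z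
    rw [ddz_add (hJ.mul (hh.iterate_ddz _)) ((hh.iterate_ddz _).const_mul _),
      ddz_mul hJ (hh.iterate_ddz _), ddz_const_mul (hh.iterate_ddz _), hc,
      ← Function.iterate_succ_apply' ddz, ← Function.iterate_succ_apply' ddz]
    push_cast; ring

/-- The automorphy factor `c z + d`. -/
def autFactor (γ : SL(2, ℝ)) (z : ℍ) : ℂ := (γ 1 0 : ℂ) * z + (γ 1 1 : ℂ)

theorem det_complex (γ : SL(2, ℝ)) : (γ 0 0 : ℂ) * γ 1 1 - γ 0 1 * γ 1 0 = 1 := by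
  have := γ.det_coe
  rw [Matrix.det_fin_two] at this
  exact_mod_cast congrArg (fun x : ℝ => (x : ℂ)) this

theorem autFactor_ne_zero (γ : SL(2, ℝ)) (z : ℍ) : autFactor γ z ≠ 0 := by
  intro h
  have hi := congrArg Complex.im h
  have hr := congrArg Complex.re h
  simp [autFactor] at hi hr
  have := det_complex γ
  rcases hi with hi | hi
  · rw [hi] at hr; simp at hr
    rw [hi, hr] at this; simp at this
  · exact z.im_pos.ne' hi

theorem coe_sl_smul (γ : SL(2, ℝ)) (z : ℍ) :
    ((γ • z : ℍ) : ℂ) = ((γ 0 0 : ℂ) * z + γ 0 1) / autFactor γ z := by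
  rw [UpperHalfPlane.coe_specialLinearGroup_apply]; rfl

theorem hasDerivAt_moebius (γ : SL(2, ℝ)) (z : ℍ) :
    HasDerivAt (fun w : ℂ => ((γ 0 0 : ℂ) * w + γ 0 1) / ((γ 1 0 : ℂ) * w + γ 1 1))
      (autFactor γ z ^ (-2 : ℤ)) z := by
  have h0 : (γ 1 0 : ℂ) * z + γ 1 1 ≠ 0 := autFactor_ne_zero γ z
  have h := (((hasDerivAt_id (z : ℂ)).const_mul (γ 0 0 : ℂ)).add_const (γ 0 1 : ℂ)).div
    (((hasDerivAt_id (z : ℂ)).const_mul (γ 1 0 : ℂ)).add_const (γ 1 1 : ℂ)) h0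
  refine h.congr_deriv ?_
  rw [zpow_neg]
  simp only [id, autFactor]
  have := det_complex γ
  rw [div_eq_iff (pow_ne_zero 2 h0), show (2 : ℤ) = ((2 : ℕ) : ℤ) from rfl, zpow_natCast,
    inv_mul_cancel₀ (pow_ne_zero 2 h0)]
  linear_combination this

theorem isSmooth_autFactor (γ : SL(2, ℝ)) : IsSmooth (autFactor γ) :=
  isSmooth_of_differentiableOn (F := fun w => (γ 1 0 : ℂ) * w + γ 1 1) (fun _ => rfl)
    (by fun_prop)

theorem ddz_autFactor (γ : SL(2, ℝ)) (z : ℍ) : ddz (autFactor γ) z = γ 1 0 :=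
  ddz_of_hasDerivAt (F := fun w => (γ 1 0 : ℂ) * w + γ 1 1) (fun _ => rfl)
    (by simpa using ((hasDerivAt_id (z : ℂ)).const_mul (γ 1 0 : ℂ)).add_const (γ 1 1 : ℂ))

theorem ddz_autFactor_zpow (γ : SL(2, ℝ)) (n : ℤ) (z : ℍ) :
    ddz (fun z => autFactor γ z ^ n) z = n * autFactor γ z ^ (n - 1) * γ 1 0 := by
  have h0 : (γ 1 0 : ℂ) * z + γ 1 1 ≠ 0 := autFactor_ne_zero γ z
  refine ddz_of_hasDerivAt (F := fun w => ((γ 1 0 : ℂ) * w + γ 1 1) ^ n) (fun _ => rfl) ?_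
  have h : HasDerivAt (fun w : ℂ => (γ 1 0 : ℂ) * w + γ 1 1) (γ 1 0 : ℂ) z := by
    simpa using ((hasDerivAt_id (z : ℂ)).const_mul (γ 1 0 : ℂ)).add_const (γ 1 1 : ℂ)
  exact (hasDerivAt_zpow n _ (Or.inl h0)).comp (z : ℂ) h

theorem IsSmooth.comp_sl {g : ℍ → ℂ} (hg : IsSmooth g) (γ : SL(2, ℝ)) :
    IsSmooth (fun z => g (γ • z)) := by
  refine isSmooth_of_contDiffAt fun z => ?_
  have h0 : (γ 1 0 : ℂ) * z + γ 1 1 ≠ 0 := autFactor_ne_zero γ z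
  have h2 : ContDiffAt ℝ ∞
      (fun w : ℂ => ((γ 0 0 : ℂ) * w + γ 0 1) / ((γ 1 0 : ℂ) * w + γ 1 1)) z := by
    refine ContDiffAt.restrict_scalars (𝕜' := ℂ) ℝ ?_
    generalize (γ 0 0 : ℂ) = a at *
    generalize (γ 0 1 : ℂ) = b at *
    generalize (γ 1 0 : ℂ) = c at *
    generalize (γ 1 1 : ℂ) = d at *
    exact ContDiffAt.div (by fun_prop) (by fun_prop) h0
  have h3 : ContDiffAt ℝ ∞ (fun w : ℂ => g (UpperHalfPlane.ofComplex w))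
      (((γ 0 0 : ℂ) * z + γ 0 1) / ((γ 1 0 : ℂ) * z + γ 1 1)) := by
    have := hg.contDiffAt (γ • z)
    rwa [coe_sl_smul] at this
  refine (h3.comp (z : ℂ) h2).congr_of_eventuallyEq
    (ofComplex_eventuallyEq (f := fun z => g (γ • z)) (fun z => ?_) z)
  have := coe_sl_smul γ z
  simp only [autFactor] at this
  simp [← this]

theorem ddz_comp_sl {g : ℍ → ℂ} (hg : IsSmooth g) (γ : SL(2, ℝ)) (z : ℍ) :
    ddz (fun z => g (γ • z)) z = autFactor γ z ^ (-2 : ℤ) * ddz g (γ • z) :=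
  ddz_comp hg (fun z => coe_sl_smul γ z) (hasDerivAt_moebius γ z)

/-- Bol's identity. -/
theorem iterate_ddz_slash {g : ℍ → ℂ} (hg : IsSmooth g) (γ : SL(2, ℝ)) (m : ℕ) :
    ddz^[m] (fun z => autFactor γ z ^ ((m : ℤ) - 1) * g (γ • z)) =
      fun z => autFactor γ z ^ (-(m : ℤ) - 1) * ddz^[m] g (γ • z) := by
  induction m with
  | zero => simp
  | succ m ih =>
    have hJ := (isSmooth_autFactor γ)
    have hz : ∀ n : ℤ, IsSmooth (fun z => autFactor γ z ^ n) := hJ.zpow (autFactor_ne_zero γ)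
    have e : (fun z => autFactor γ z ^ (((m + 1 : ℕ) : ℤ) - 1) * g (γ • z)) =
        fun z => autFactor γ z * (autFactor γ z ^ ((m : ℤ) - 1) * g (γ • z)) := by
      ext z
      rw [← mul_assoc, ← zpow_one_add₀ (autFactor_ne_zero γ z)]
      congr 2; push_cast; ring
    rw [e, iterate_ddz_linear_mul hJ ((hz _).mul (hg.comp_sl γ)) (ddz_autFactor γ),
      Function.iterate_succ_apply', ih]
    ext z
    have h0 := autFactor_ne_zero γ z
    rw [ddz_mul (hz _) ((hg.iterate_ddz m).comp_sl γ), ddz_comp_sl (hg.iterate_ddz m),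
      ddz_autFactor_zpow, ← Function.iterate_succ_apply' ddz m g, Nat.succ_eq_add_one]
    have e1 : autFactor γ z ^ (-(m : ℤ) - 1) =
        autFactor γ z * autFactor γ z ^ (-(m : ℤ) - 1 - 1) := by
      rw [← zpow_one_add₀ h0]; congr 1; ring
    have e2 : autFactor γ z ^ (-((m + 1 : ℕ) : ℤ) - 1) = autFactor γ z ^ (-(m : ℤ) - 1 - 1) := by
      congr 1; push_cast; ring
    have e3 : autFactor γ z * autFactor γ z * autFactor γ z ^ (-2 : ℤ) = 1 := by
      rw [zpow_neg, show (2 : ℤ) = ((2 : ℕ) : ℤ) from rfl, zpow_natCast, ← sq,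
        mul_inv_cancel₀ (pow_ne_zero 2 h0)]
    rw [e2]
    push_cast
    linear_combination (autFactor γ z ^ (-(m : ℤ) - 1 - 1) * ddz^[m + 1] g (γ • z)) * e3 +
      (m + 1) * γ 1 0 * ddz^[m] g (γ • z) * e1 +
      autFactor γ z * autFactor γ z ^ (-2 : ℤ) * ddz^[m + 1] g (γ • z) * e1

theorem bolD_slash {g : ℍ → ℂ} (hg : IsSmooth g) (γ : SL(2, ℝ)) (m : ℕ) (z : ℍ) :
    bolD m (fun z => autFactor γ z ^ ((m : ℤ) - 1) * g (γ • z)) z =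
      autFactor γ z ^ (-(m : ℤ) - 1) * bolD m g (γ • z) := by
  simp only [bolD, iterate_ddz_slash hg]
  ring

/-! ### Weights and multipliers of the conjugated operator -/

/-- The principal square root of `c z + d`. -/
def sqrtAut (γ : SL(2, ℝ)) (z : ℍ) : ℂ := autFactor γ z ^ (1 / 2 : ℂ)

theorem cpow_int_div_two (x : ℂ) (n : ℤ) : x ^ ((n : ℂ) / 2) = (x ^ (1 / 2 : ℂ)) ^ n := by
  rw [← Complex.cpow_mul_int]; congr 1; ring

theorem sqrtAut_ne_zero (γ : SL(2, ℝ)) (z : ℍ) : sqrtAut γ z ≠ 0 := by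
  simp [sqrtAut, Complex.cpow_eq_zero_iff, autFactor_ne_zero]

theorem autFactor_zpow (γ : SL(2, ℝ)) (z : ℍ) (n : ℤ) :
    autFactor γ z ^ n = sqrtAut γ z ^ (2 * n) := by
  rw [sqrtAut, zpow_mul, ← Complex.cpow_mul_int]; norm_num

/-- Every half-integral power of `c z + d` is an integral power of the one root `sqrtAut`, so no
branch question arises. The inner product contributes `A₀^(3a-1) A₁^(-a)`, the outer one `A₀^(2-3a)
A₁^(a-1)`; together they give `A₀ / A₁`. -/
theorem delta_slash {N₀ N₁ : ℕ} {ψ₀ : DirichletCharacter ℂ N₀} {ψ₁ : DirichletCharacter ℂ N₁}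
    (h₀ : IsSmooth (theta0 ψ₀)) (h₁ : IsSmooth (theta1 ψ₁))
    (hn₀ : ∀ z, theta0 ψ₀ z ≠ 0) (hn₁ : ∀ z, theta1 ψ₁ z ≠ 0)
    {γ : SL(2, ℝ)} {A₀ A₁ : ℂ} (hA₀ : ∀ z, theta0 ψ₀ (γ • z) = A₀ * sqrtAut γ z * theta0 ψ₀ z)
    (hA₁ : ∀ z, theta1 ψ₁ (γ • z) = A₁ * sqrtAut γ z ^ 3 * theta1 ψ₁ z)
    (m : ℕ) (a : ℤ) {k : ℝ} (hk : (m : ℝ) = k - 3 / 2) {f : ℍ → ℂ} (hf : IsSmooth f) (C : ℂ)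
    (z : ℍ) :
    delta ψ₀ ψ₁ m a (fun z => C * autFactor γ z ^ (-((2 - k : ℝ) : ℂ)) * f (γ • z)) z =
      C * (A₀ / A₁) * autFactor γ z ^ (-(k : ℂ)) * delta ψ₀ ψ₁ m a f (γ • z) := by
  have hA₀' : A₀ ≠ 0 := fun h => hn₀ (γ • z) (by rw [hA₀, h]; simp)
  have hA₁' : A₁ ≠ 0 := fun h => hn₁ (γ • z) (by rw [hA₁, h]; simp)
  obtain rfl : k = m + 3 / 2 := by linarith
  have e1 : ∀ z, autFactor γ z ^ (-((2 - (m + 3 / 2) : ℝ) : ℂ)) =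
      sqrtAut γ z ^ (2 * (m : ℤ) - 1) := fun z => by
    rw [sqrtAut, ← cpow_int_div_two]; congr 1; push_cast; ring
  have e2 : autFactor γ z ^ (-((m + 3 / 2 : ℝ) : ℂ)) = sqrtAut γ z ^ (-(2 * (m : ℤ)) - 3) := by
    rw [sqrtAut, ← cpow_int_div_two]; congr 1; push_cast; ring
  set g : ℍ → ℂ := fun w => theta0 ψ₀ w ^ (1 - 3 * a) * theta1 ψ₁ w ^ a * f w with hg_def
  have hg : IsSmooth g := ((h₀.zpow hn₀ _).mul (h₁.zpow hn₁ _)).mul hf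
  have e3 : (fun w => theta0 ψ₀ w ^ (1 - 3 * a) * theta1 ψ₁ w ^ a *
      (C * autFactor γ w ^ (-((2 - (m + 3 / 2) : ℝ) : ℂ)) * f (γ • w))) =
      fun w => (C * A₀ ^ (3 * a - 1) * A₁ ^ (-a)) *
        (autFactor γ w ^ ((m : ℤ) - 1) * g (γ • w)) := by
    ext w
    rw [hg_def, e1, autFactor_zpow]
    simp only [hA₀, hA₁]
    have hs := sqrtAut_ne_zero γ w
    have hs3 : (sqrtAut γ w ^ 3) ^ a = (sqrtAut γ w ^ a) ^ 3 := by
      rw [← zpow_natCast, ← zpow_natCast, zpow_comm]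
    have hX := hn₀ w
    have hY := hn₁ w
    simp only [mul_zpow, zpow_sub₀ hs, zpow_sub₀ hA₀', zpow_sub₀ hX, mul_sub, zpow_neg, mul_one,
      mul_comm (3 : ℤ) a, zpow_mul, zpow_one, hs3]
    have := zpow_ne_zero a hs
    have := zpow_ne_zero a hX
    have := zpow_ne_zero a hY
    have := zpow_ne_zero a hA₀'
    have := zpow_ne_zero a hA₁'
    field_simp
  unfold delta
  rw [e3, bolD_const_mul (((isSmooth_autFactor γ).zpow (autFactor_ne_zero γ) _).mul
    (hg.comp_sl γ)), bolD_slash hg, e2, autFactor_zpow, ← hg_def]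
  simp only [hA₀, hA₁]
  generalize bolD m g (γ • z) = B
  have hs := sqrtAut_ne_zero γ z
  have hs3 : (sqrtAut γ z ^ 3) ^ a = (sqrtAut γ z ^ a) ^ 3 := by
    rw [← zpow_natCast, ← zpow_natCast, zpow_comm]
  have hX := hn₀ z
  have hY := hn₁ z
  simp only [mul_zpow, zpow_sub₀ hs, zpow_sub₀ hA₀', zpow_sub₀ hX, zpow_sub₀ hY, zpow_sub₀ hA₁', zpow_sub₀ (pow_ne_zero 3 hs),
    mul_sub, zpow_neg, mul_one, mul_neg,
    mul_comm (3 : ℤ) a, zpow_mul, zpow_one, hs3]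
  have := zpow_ne_zero a hs
  have := zpow_ne_zero a hX
  have := zpow_ne_zero a hY
  have := zpow_ne_zero a hA₀'
  have := zpow_ne_zero a hA₁'
  field_simp

/-! ### Periodicity of the Kronecker symbol -/

theorem jacobiSym_congr_right (a : ℤ) {b b' : ℕ} (hb : Odd b) (hb' : Odd b')
    (h : b ≡ b' [MOD 4 * a.natAbs]) : jacobiSym a b = jacobiSym a b' := by
  rw [jacobiSym.mod_right a hb, jacobiSym.mod_right a hb', h]

/-- Modulo `4a - 1` the number `4a` is 1, and the factor 4 is a square. -/
theorem jacobiSym_four_mul_sub_one {a : ℕ} (ha : 0 < a) : jacobiSym a (4 * a - 1) = 1 := by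
  have hodd : Odd (4 * a - 1) := ⟨2 * a - 1, by omega⟩
  have h : jacobiSym (4 * a : ℤ) (4 * a - 1) = 1 := by
    rw [← jacobiSym.one_left (4 * a - 1)]
    refine jacobiSym.mod_left' (Int.ModEq.symm (Int.modEq_iff_dvd.mpr ⟨1, ?_⟩))
    push_cast [show 1 ≤ 4 * a by omega]; ring
  rwa [jacobiSym.mul_left, jacobiSym.at_four hodd, one_mul] at h

/-- Since `b' ≡ -b`, one has `b b' ≡ b² (4a - 1)` modulo `4a`, and the symbol depends only on this
class. Keeping the square on the right covers the case that `a` and `b` are not coprime. -/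
theorem jacobiSym_mul_reflect {a b b' : ℕ} (ha : 0 < a) (hb : Odd b) (hb' : Odd b')
    (h : b + b' = 4 * a) : jacobiSym a b * jacobiSym a b' = jacobiSym a b ^ 2 := by
  have hodd : Odd (4 * a - 1) := ⟨2 * a - 1, by omega⟩
  have h1 : jacobiSym a (b * b') = jacobiSym a (b ^ 2 * (4 * a - 1)) := by
    refine jacobiSym_congr_right _ (hb.mul hb') (hb.pow.mul hodd) ?_
    obtain rfl : b' = 4 * a - b := by omega
    rw [Nat.modEq_iff_dvd]
    refine ⟨(b : ℤ) ^ 2 - b, ?_⟩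
    push_cast [show 1 ≤ 4 * a by omega, show b ≤ 4 * a by omega, Int.natAbs_natCast]
    ring
  rwa [jacobiSym.mul_right' _ hb.pos.ne' hb'.pos.ne',
    jacobiSym.mul_right' _ (pow_ne_zero 2 hb.pos.ne') (by omega),
    jacobiSym_four_mul_sub_one ha, jacobiSym.pow_right, mul_one] at h1

/-- Reflection: for `a > 0` the Jacobi symbol is even modulo `4a` in its lower argument. -/
theorem jacobiSym_reflect_pos {a b b' : ℕ} (ha : 0 < a) (hb : Odd b) (hb' : Odd b')
    (h : b + b' = 4 * a) : jacobiSym a b = jacobiSym a b' := by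
  have h1 := jacobiSym_mul_reflect ha hb hb' h
  have h2 := jacobiSym_mul_reflect ha hb' hb (by omega)
  have h3 : (jacobiSym a b - jacobiSym a b') ^ 2 = 0 := by linear_combination -h1 - h2
  linarith [pow_eq_zero_iff (two_ne_zero) |>.mp h3]

/-- The sign is that of `(-1 / ·)`: as `b + b'` is divisible by 4, one of the two odd numbers is 1
and the other 3 modulo 4. -/
theorem jacobiSym_reflect_neg {a b b' : ℕ} (ha : 0 < a) (hb : Odd b) (hb' : Odd b')
    (h : b + b' = 4 * a) : jacobiSym (-a) b = -jacobiSym (-a) b' := by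
  rw [jacobiSym.neg _ hb, jacobiSym.neg _ hb', jacobiSym_reflect_pos ha hb hb' h,
    ZMod.χ₄_nat_eq_if_mod_four, ZMod.χ₄_nat_eq_if_mod_four]
  have := Nat.odd_iff.mp hb
  have := Nat.odd_iff.mp hb'
  rcases Nat.odd_mod_four_iff.mp (Nat.odd_iff.mp hb) with h4 | h4
  · have : b' % 4 = 3 := by omega
    simp [*]
  · have : b' % 4 = 1 := by omega
    simp [*]

theorem jacobiSym_four_mul (c : ℤ) {b : ℕ} (hb : Odd b) : jacobiSym (4 * c) b = jacobiSym c b := by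
  rw [jacobiSym.mul_left, jacobiSym.at_four hb, one_mul]

/-- The Kronecker symbol `(c / ·)` has period `c` when `4 ∣ c`. -/
theorem kroneckerSym_add_right {c d : ℤ} (hc : 4 ∣ c) (hc0 : c ≠ 0) (hd : Odd d) :
    kroneckerSym c (d + c) = kroneckerSym c d := by
  obtain ⟨c, rfl⟩ := hc
  have h1 : Odd d.natAbs := Int.natAbs_odd.mpr hd
  have h2 : Odd (d + 4 * c).natAbs :=
    Int.natAbs_odd.mpr (hd.add_even (by rw [Int.even_mul]; left; decide))
  have hd0 : d ≠ 0 := by rintro rfl; simp at hd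
  have hd1 : d + 4 * c ≠ 0 := by intro h; rw [h] at h2; simp at h2
  unfold kroneckerSym
  rw [jacobiSym_four_mul c h1, jacobiSym_four_mul c h2]
  by_cases hs : (0 < d ↔ 0 < d + 4 * c)
  -- When `d` and `d + 4c` have equal signs, their absolute values are congruent modulo `4|c|`.
  · have e : jacobiSym c (d + 4 * c).natAbs = jacobiSym c d.natAbs := by
      refine jacobiSym_congr_right c h2 h1 ?_
      rw [Nat.modEq_iff_dvd]
      push_cast
      rcases lt_or_gt_of_ne hd0 with h | h
      · rw [abs_of_neg h, abs_of_neg (show d + 4 * c < 0 by omega)]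
        have : (4 * |c|) ∣ (4 * c) := mul_dvd_mul_left 4 ((abs_dvd _ _).mpr dvd_rfl)
        rw [show -d - -(d + 4 * c) = 4 * c by ring]; exact this
      · rw [abs_of_pos h, abs_of_pos (show 0 < d + 4 * c by omega)]
        have : (4 * |c|) ∣ (4 * c) := mul_dvd_mul_left 4 ((abs_dvd _ _).mpr dvd_rfl)
        rw [show d - (d + 4 * c) = -(4 * c) by ring]; exact this.neg_right
    rw [e]
    congr 2
    apply propext
    omega
  -- For opposite signs the absolute values add up to `4|c|`, so reflection applies. Its sign for `c
  -- < 0` is compensated by the convention for two negative arguments.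
  · rcases lt_or_gt_of_ne (show c ≠ 0 by rintro rfl; simp at hc0) with h | h
    · obtain ⟨n, rfl⟩ : ∃ n : ℕ, c = -(n : ℤ) := ⟨c.natAbs, by omega⟩
      rw [jacobiSym_reflect_neg (by omega) h2 h1 (by omega), if_pos (by omega), if_neg (by omega)]
      ring
    · obtain ⟨n, rfl⟩ : ∃ n : ℕ, c = (n : ℤ) := ⟨c.natAbs, by omega⟩
      rw [jacobiSym_reflect_pos (by omega) h2 h1 (by omega), if_neg (by omega), if_neg (by omega)]

/-- The Jacobi symbols agree modulo `|d|`. The sign conventions are kept explicit, since they are to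
be matched with those in `sqrt_cocycle_sign`. -/
theorem kroneckerSym_add_left (c d : ℤ) :
    kroneckerSym (c + 4 * d) d * (if c < 0 ∧ d < 0 then -1 else 1) =
      (if c + 4 * d < 0 ∧ d < 0 then -1 else 1) * kroneckerSym c d := by
  have : jacobiSym (c + 4 * d) d.natAbs = jacobiSym c d.natAbs := by
    refine jacobiSym.mod_left' (Int.ModEq.symm (Int.modEq_iff_dvd.mpr ?_))
    rw [add_sub_cancel_left]
    exact (Int.natAbs_dvd.mpr dvd_rfl).mul_left 4
  unfold kroneckerSym
  rw [this]; ring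

/-- For `d < 0` the convention for two negative arguments makes `(-1 / d)` depend on `d` modulo 4
just as for `d > 0`. -/
theorem epsilon_sq {d : ℤ} (hd : Odd d) : epsilon d ^ 2 = kroneckerSym (-1) d := by
  have h1 : Odd d.natAbs := Int.natAbs_odd.mpr hd
  rw [Int.odd_iff] at hd
  unfold epsilon kroneckerSym
  rw [jacobiSym.at_neg_one h1, ZMod.χ₄_nat_eq_if_mod_four]
  have h2 := Nat.odd_iff.mp h1
  by_cases hd0 : d < 0 <;> by_cases h4 : d % 4 = 1
  · have : d.natAbs % 4 = 3 := by omega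
    simp [*]
  · have : d.natAbs % 4 = 1 := by omega
    simp [*]
  · have : d.natAbs % 4 = 1 := by omega
    simp [*]
  · have : d.natAbs % 4 = 3 := by omega
    simp [*]

theorem epsilon_ne_zero (d : ℤ) : epsilon d ≠ 0 := by
  unfold epsilon; split_ifs <;> simp

theorem epsilon_pow_four (d : ℤ) : epsilon d ^ 4 = 1 := by
  unfold epsilon; split_ifs <;> simp

/-! ### Principal square roots of products -/

theorem sqrt_sq (x : ℂ) : (x ^ (1 / 2 : ℂ)) ^ 2 = x := by
  rw [one_div]; exact Complex.cpow_nat_inv_pow x two_ne_zero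

theorem sqrt_re (x : ℂ) : (x ^ (1 / 2 : ℂ)).re = ‖x‖ ^ (1 / 2 : ℝ) * Real.cos (x.arg / 2) := by
  have := Complex.cpow_ofReal_re x (1 / 2)
  push_cast at this
  rw [this]; congr 2; ring

theorem sqrt_im (x : ℂ) : (x ^ (1 / 2 : ℂ)).im = ‖x‖ ^ (1 / 2 : ℝ) * Real.sin (x.arg / 2) := by
  have := Complex.cpow_ofReal_im x (1 / 2)
  push_cast at this
  rw [this]; congr 2; ring

theorem sqrt_re_pos {x : ℂ} (hx : x.im ≠ 0 ∨ 0 < x.re) : 0 < (x ^ (1 / 2 : ℂ)).re := by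
  have h0 : x ≠ 0 := by rintro rfl; simp at hx
  rw [sqrt_re]
  have h1 : x.arg < Real.pi := by rw [Complex.arg_lt_pi_iff]; exact hx.symm.imp le_of_lt id
  refine mul_pos (Real.rpow_pos_of_pos (norm_pos_iff.mpr h0) _) (Real.cos_pos_of_mem_Ioo ⟨?_, ?_⟩) <;>
    linarith [Complex.neg_pi_lt_arg x]

theorem sqrt_im_pos {x : ℂ} (hx : 0 < x.im ∨ (x.im = 0 ∧ x.re < 0)) :
    0 < (x ^ (1 / 2 : ℂ)).im := by
  have h0 : x ≠ 0 := by rintro rfl; simp at hx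
  rw [sqrt_im]
  have h2 : 0 ≤ x.arg := by rw [Complex.arg_nonneg_iff]; rcases hx with h | h <;> linarith
  have h3 : x.arg ≠ 0 := by
    rw [Ne, Complex.arg_eq_zero_iff]
    rintro ⟨h4, h5⟩
    rcases hx with h | h <;> linarith
  refine mul_pos (Real.rpow_pos_of_pos (norm_pos_iff.mpr h0) _)
    (Real.sin_pos_of_pos_of_lt_pi (by positivity) ?_)
  linarith [Complex.arg_le_pi x, Real.pi_pos]

theorem sqrt_im_neg {x : ℂ} (hx : x.im < 0) : (x ^ (1 / 2 : ℂ)).im < 0 := by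
  have h0 : x ≠ 0 := by rintro rfl; simp at hx
  rw [sqrt_im]
  have h2 : x.arg < 0 := by rwa [Complex.arg_neg_iff]
  refine mul_neg_of_pos_of_neg (Real.rpow_pos_of_pos (norm_pos_iff.mpr h0) _)
    (Real.sin_neg_of_neg_of_neg_pi_lt (by linarith) ?_)
  linarith [Complex.neg_pi_lt_arg x, Real.pi_pos]

theorem sqrt_mul_sqrt_or (A B : ℂ) :
    (A * B) ^ (1 / 2 : ℂ) = A ^ (1 / 2 : ℂ) * B ^ (1 / 2 : ℂ) ∨
      (A * B) ^ (1 / 2 : ℂ) = -(A ^ (1 / 2 : ℂ) * B ^ (1 / 2 : ℂ)) := by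
  rw [← sq_eq_sq_iff_eq_or_eq_neg, mul_pow]
  simp only [sqrt_sq]

/-- `√A √B = √(AB)` for principal square roots when both sides have positive real part. -/
theorem sqrt_mul_of_re_pos {A B : ℂ} (h : 0 < ((A * B) ^ (1 / 2 : ℂ)).re)
    (h' : 0 < (A ^ (1 / 2 : ℂ) * B ^ (1 / 2 : ℂ)).re) :
    (A * B) ^ (1 / 2 : ℂ) = A ^ (1 / 2 : ℂ) * B ^ (1 / 2 : ℂ) := by
  rcases sqrt_mul_sqrt_or A B with h1 | h1
  · exact h1
  · rw [h1, Complex.neg_re] at h; linarith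

theorem sqrt_mul_of_im_pos {A B : ℂ} (h : 0 < ((A * B) ^ (1 / 2 : ℂ)).im)
    (h' : 0 < (A ^ (1 / 2 : ℂ) * B ^ (1 / 2 : ℂ)).im) :
    (A * B) ^ (1 / 2 : ℂ) = A ^ (1 / 2 : ℂ) * B ^ (1 / 2 : ℂ) := by
  rcases sqrt_mul_sqrt_or A B with h1 | h1
  · exact h1
  · rw [h1, Complex.neg_im] at h; linarith

theorem sqrt_mul_of_im_neg {A B : ℂ} (h : ((A * B) ^ (1 / 2 : ℂ)).im < 0)
    (h' : 0 < (A ^ (1 / 2 : ℂ) * B ^ (1 / 2 : ℂ)).im) :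
    (A * B) ^ (1 / 2 : ℂ) = -(A ^ (1 / 2 : ℂ) * B ^ (1 / 2 : ℂ)) := by
  rcases sqrt_mul_sqrt_or A B with h1 | h1
  · rw [h1] at h; linarith
  · exact h1

theorem abs_sqrt_im_lt {x : ℂ} (hx : 0 < x.re) : |(x ^ (1 / 2 : ℂ)).im| < (x ^ (1 / 2 : ℂ)).re := by
  have h1 := sqrt_re_pos (Or.inr hx)
  have h2 := congrArg Complex.re (sqrt_sq x)
  rw [sq, Complex.mul_re] at h2
  exact abs_lt_of_sq_lt_sq (by nlinarith) h1.le

/-- The roots `P` of `A B` and `Q` of `A` lie in the sector `|arg| < π/4`, so `P` times the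
conjugate of `Q` has positive real part. With `S` the root of `B`, the wrong sign `P = -Q S` would
make this real part `-|Q|² Re S ≤ 0`. -/
theorem sqrt_mul_of_re_pos_left {A B : ℂ} (hA : 0 < A.re) (hAB : 0 < (A * B).re)
    (hB : 0 < (B ^ (1 / 2 : ℂ)).re) :
    (A * B) ^ (1 / 2 : ℂ) = A ^ (1 / 2 : ℂ) * B ^ (1 / 2 : ℂ) := by
  rcases sqrt_mul_sqrt_or A B with h | h
  · exact h
  · exfalso
    have h1 := abs_lt.mp (abs_sqrt_im_lt hA)
    have h2 := abs_lt.mp (abs_sqrt_im_lt hAB)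
    generalize (A * B) ^ (1 / 2 : ℂ) = P at *
    generalize A ^ (1 / 2 : ℂ) = Q at *
    generalize B ^ (1 / 2 : ℂ) = S at *
    have hr := congrArg Complex.re h
    have hi := congrArg Complex.im h
    rw [Complex.neg_re, Complex.mul_re] at hr
    rw [Complex.neg_im, Complex.mul_im] at hi
    have h3 : P.re * Q.re + P.im * Q.im = -(Q.re ^ 2 + Q.im ^ 2) * S.re := by rw [hr, hi]; ring
    have h4 : 0 < (P.re + P.im) * (Q.re + Q.im) := mul_pos (by linarith) (by linarith)
    have h5 : 0 < (P.re - P.im) * (Q.re - Q.im) := mul_pos (by linarith) (by linarith)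
    have h6 : 0 ≤ (Q.re ^ 2 + Q.im ^ 2) * S.re := by positivity
    linarith

/-- The sign in the composition law of the automorphy factors of `γ` and `(1 0; 4 1)`. -/
theorem sqrt_cocycle_sign {c d : ℤ} (hd : d ≠ 0) {A B z : ℂ} (hz : 0 < z.im) (hB : B = 4 * z + 1)
    (hAB : A * B = (c + 4 * d) * z + d) (hA : 0 < c → 0 < A.im) (hA' : c < 0 → A.im < 0)
    (hA0 : c = 0 → A = d) :
    (if c + 4 * d < 0 ∧ d < 0 then -1 else 1) * (A * B) ^ (1 / 2 : ℂ) =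
      (if c < 0 ∧ d < 0 then -1 else 1) * (A ^ (1 / 2 : ℂ) * B ^ (1 / 2 : ℂ)) := by
  have hBim : 0 < B.im := by rw [hB]; simpa using hz
  have hABim : (A * B).im = ((c + 4 * d : ℤ) : ℝ) * z.im := by rw [hAB]; simp
  have hABre : (A * B).re = ((c + 4 * d : ℤ) : ℝ) * z.re + d := by rw [hAB]; simp
  have hQr := sqrt_re_pos (Or.inl hBim.ne')
  have hQi := sqrt_im_pos (Or.inl hBim)
  have hpos : 0 < c + 4 * d → 0 < (A * B).im := fun h => by
    rw [hABim]; exact mul_pos (by exact_mod_cast h) hz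
  have hneg : c + 4 * d < 0 → (A * B).im < 0 := fun h => by
    rw [hABim]; exact mul_neg_of_neg_of_pos (by exact_mod_cast h) hz
  rcases lt_trichotomy c 0 with hc | hc | hc
  -- For `c < 0` the roots of `A` and `B` lie in the fourth and the first quadrant, so their product
  -- has positive real part. The two sign factors coincide.
  · have hPr := sqrt_re_pos (Or.inl (hA' hc).ne)
    have hPi := sqrt_im_neg (hA' hc)
    simp only [show (c + 4 * d < 0 ∧ d < 0) ↔ (c < 0 ∧ d < 0) by omega]
    rw [sqrt_mul_of_re_pos]
    · refine sqrt_re_pos ?_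
      rcases lt_trichotomy (c + 4 * d) 0 with h | h | h
      · exact Or.inl (hneg h).ne
      · right
        rw [hABre, h]
        have : 0 < d := by omega
        simpa using this
      · exact Or.inl (hpos h).ne'
    · rw [Complex.mul_re]
      nlinarith
  -- For `c = 0` the number `A = d` is real; its root is positive imaginary if `d < 0` and positive
  -- if `d > 0`.
  · rw [if_neg (show ¬(c < 0 ∧ d < 0) by omega)]
    rcases lt_or_gt_of_ne hd with h | h
    · have hP : 0 < (A ^ (1 / 2 : ℂ)).im :=
        sqrt_im_pos (Or.inr (by rw [hA0 hc]; simpa using h))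
      have hP' : (A ^ (1 / 2 : ℂ)).re = 0 := by
        rw [sqrt_re, hA0 hc, ← Complex.ofReal_intCast, Complex.arg_ofReal_of_neg (by exact_mod_cast h)]
        simp
      rw [if_pos (by omega), sqrt_mul_of_im_neg (sqrt_im_neg (hneg (by omega)))]
      · ring
      · rw [Complex.mul_im, hP']; nlinarith
    · have hP : 0 < (A ^ (1 / 2 : ℂ)).re :=
        sqrt_re_pos (Or.inr (by rw [hA0 hc]; simpa using h))
      have hP' : (A ^ (1 / 2 : ℂ)).im = 0 := by
        rw [sqrt_im, hA0 hc, ← Complex.ofReal_intCast, Complex.arg_ofReal_of_nonneg (by exact_mod_cast h.le)]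
        simp
      rw [if_neg (by omega), sqrt_mul_of_im_pos (sqrt_im_pos (Or.inl (hpos (by omega))))]
      rw [Complex.mul_im, hP']; nlinarith
  -- For `c > 0` both roots lie in the first quadrant, so the product is in the upper half-plane,
  -- and the root of `A B` leaves it exactly when `c + 4d < 0`. If `c + 4d = 0`, then `A B = d < 0`
  -- has a positive imaginary root.
  · have hPr := sqrt_re_pos (Or.inl (hA hc).ne')
    have hPi := sqrt_im_pos (Or.inl (hA hc))
    have hPQ : 0 < (A ^ (1 / 2 : ℂ) * B ^ (1 / 2 : ℂ)).im := by
      rw [Complex.mul_im]; positivity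
    rw [if_neg (show ¬(c < 0 ∧ d < 0) by omega)]
    rcases lt_trichotomy (c + 4 * d) 0 with h | h | h
    · rw [if_pos (by omega), sqrt_mul_of_im_neg (sqrt_im_neg (hneg h)) hPQ]; ring
    · rw [if_neg (by omega), sqrt_mul_of_im_pos (sqrt_im_pos (Or.inr ⟨?_, ?_⟩)) hPQ]
      · rw [hABim, h]; simp
      · rw [hABre, h]
        have : d < 0 := by omega
        simpa using this
    · rw [if_neg (by omega), sqrt_mul_of_im_pos (sqrt_im_pos (Or.inl (hpos h))) hPQ]

/-! ### The theta transformation law for matrices with `4 ∣ c` -/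

theorem jacobiTheta₂_add_two_mul_int (w τ : ℂ) (n : ℤ) :
    jacobiTheta₂ w (τ + 2 * n) = jacobiTheta₂ w τ := by
  have h : Function.Periodic (jacobiTheta₂ w) 2 := jacobiTheta₂_add_right w
  rw [mul_comm]; exact h.int_mul n τ

/-- Inversion conjugates `(1 0; 4 1)` into a translation: for `z' = z / (4z + 1)` the values `-1 /
(2z)` and `-1 / (2z')` differ by 2, a period of theta. So the functional equation is applied on both
sides. -/
theorem jacobiTheta₂_lower_four {z : ℂ} (hz : 0 < z.im) (w : ℂ) :
    jacobiTheta₂ (w / (4 * z + 1)) (2 * (z / (4 * z + 1))) =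
      (4 * z + 1) ^ (1 / 2 : ℂ) * Complex.exp (2 * Real.pi * Complex.I * w ^ 2 / (4 * z + 1)) *
        jacobiTheta₂ w (2 * z) := by
  have hz0 : z ≠ 0 := by rintro rfl; simp at hz
  have hB0 : 4 * z + 1 ≠ 0 := by
    intro h; have := congrArg Complex.im h; simp at this; linarith
  have hx0 : -Complex.I * (2 * (z / (4 * z + 1))) ≠ 0 := by simp [hz0, hB0]
  have hre : 0 < (-Complex.I * (2 * (z / (4 * z + 1)))).re := by
    have : z / (4 * z + 1) = (4 + z⁻¹)⁻¹ := by field_simp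
    rw [this]
    simp only [neg_mul, Complex.neg_re, Complex.mul_re, Complex.I_re, Complex.I_im, zero_mul,
      Complex.mul_im, Complex.inv_im, Complex.add_im, Complex.re_ofNat, Complex.im_ofNat]
    have h1 : 0 < Complex.normSq (4 + z⁻¹) := by
      rw [Complex.normSq_pos]
      intro h
      rw [h, inv_zero, div_eq_zero_iff] at this
      tauto
    have h2 : 0 < Complex.normSq z := Complex.normSq_pos.mpr hz0
    have : -(0 + -z.im / Complex.normSq z) / Complex.normSq (4 + z⁻¹) =
      z.im / Complex.normSq z / Complex.normSq (4 + z⁻¹) := by ring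
    rw [this]
    have : 0 < z.im / Complex.normSq z / Complex.normSq (4 + z⁻¹) := by positivity
    linarith
  have hsq : (-Complex.I * (2 * z)) ^ (1 / 2 : ℂ) =
      (-Complex.I * (2 * (z / (4 * z + 1)))) ^ (1 / 2 : ℂ) * (4 * z + 1) ^ (1 / 2 : ℂ) := by
    have e : -Complex.I * (2 * z) = -Complex.I * (2 * (z / (4 * z + 1))) * (4 * z + 1) := by
      rw [mul_assoc, mul_assoc, div_mul_cancel₀ _ hB0]
    rw [e]
    refine sqrt_mul_of_re_pos_left hre ?_ (sqrt_re_pos (Or.inl ?_))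
    · rw [← e]; simpa using hz
    · simpa using hz.ne'
  have hs0 : (-Complex.I * (2 * (z / (4 * z + 1)))) ^ (1 / 2 : ℂ) ≠ 0 := by
    simp [Complex.cpow_eq_zero_iff, hz0, hB0]
  have hs1 : (4 * z + 1) ^ (1 / 2 : ℂ) ≠ 0 := by
    rw [Ne, Complex.cpow_eq_zero_iff]; tauto
  rw [jacobiTheta₂_functional_equation (w / (4 * z + 1)), jacobiTheta₂_functional_equation w (2 * z),
    hsq]
  have e1 : w / (4 * z + 1) / (2 * (z / (4 * z + 1))) = w / (2 * z) := by field_simp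
  have e2 : -1 / (2 * z) = -1 / (2 * (z / (4 * z + 1))) + 2 := by field_simp; ring
  rw [e1, e2, jacobiTheta₂_add_right]
  have e3 : Complex.exp (-Real.pi * Complex.I * (w / (4 * z + 1)) ^ 2 / (2 * (z / (4 * z + 1)))) =
      Complex.exp (2 * Real.pi * Complex.I * w ^ 2 / (4 * z + 1)) *
      Complex.exp (-Real.pi * Complex.I * w ^ 2 / (2 * z)) := by
    rw [← Complex.exp_add]; congr 1; field_simp; ring
  rw [e3]
  generalize (-Complex.I * (2 * (z / (4 * z + 1)))) ^ (1 / 2 : ℂ) = s at *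
  generalize (4 * z + 1) ^ (1 / 2 : ℂ) = t at *
  field_simp

/-- The theta transformation law of the two-variable Jacobi theta function under the
Möbius transformation with integral entries `a b c d`, at the point `(z, w)`. -/
def ThetaLaw (a b c d : ℤ) (z w : ℂ) : Prop :=
  jacobiTheta₂ (w / (c * z + d)) (2 * ((a * z + b) / (c * z + d))) =
    kroneckerSym c d * (epsilon d)⁻¹ * (c * z + d) ^ (1 / 2 : ℂ) *
      Complex.exp (Real.pi * Complex.I * c * w ^ 2 / (2 * (c * z + d))) * jacobiTheta₂ w (2 * z)

theorem epsilon_congr {d d' : ℤ} (h : d % 4 = d' % 4) : epsilon d = epsilon d' := by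
  unfold epsilon; rw [h]

theorem linear_ne_zero_of_im_pos {c d : ℤ} (h : IsCoprime c d) {z : ℂ} (hz : 0 < z.im) :
    (c * z + d : ℂ) ≠ 0 := by
  intro h0
  have hi := congrArg Complex.im h0
  simp [hz.ne'] at hi
  subst hi
  simp at h0
  subst h0
  exact not_isCoprime_zero_zero h

theorem im_div_linear_pos (r : ℝ) {z : ℂ} (hz : 0 < z.im) : 0 < (z / (r * z + 1)).im := by
  have hB0 : r * z + 1 ≠ 0 := by
    intro h
    have hi := congrArg Complex.im h
    simp [hz.ne'] at hi
    subst hi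
    simp at h
  have h1 : 0 < Complex.normSq (r * z + 1) := Complex.normSq_pos.mpr hB0
  rw [Complex.div_im, ← sub_div]
  refine div_pos ?_ h1
  simp
  linarith

/-- Right multiplication by `(1 1; 0 1)`. Being an equivalence, it serves the descent in both
directions. -/
theorem thetaLaw_translate {a b c d : ℤ} (hc : 4 ∣ c) (hc0 : c ≠ 0) (hd : Odd d) (z w : ℂ) :
    ThetaLaw a (a + b) c (d + c) z w ↔ ThetaLaw a b c d (z + 1) w := by
  unfold ThetaLaw
  rw [kroneckerSym_add_right hc hc0 hd, epsilon_congr (show (d + c) % 4 = d % 4 by omega),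
    mul_add 2 z 1, mul_one]
  have := jacobiTheta₂_add_two_mul_int w (2 * z) 1
  rw [Int.cast_one, mul_one] at this
  rw [this]
  push_cast
  rw [show (c : ℂ) * (z + 1) + d = c * z + (d + c) by ring,
    show (a : ℂ) * (z + 1) + b = a * z + (a + b) by ring]

/-- Right multiplication by `(1 0; 4 1)`. The sign relating the square roots is the one relating the
Kronecker symbols, so the products of symbol and root agree. -/
theorem thetaLaw_lower {a b c d : ℤ} (h : IsCoprime c d) (hd : Odd d) {z : ℂ}
    (hz : 0 < z.im) (w : ℂ) :
    ThetaLaw (a + 4 * b) b (c + 4 * d) d z w ↔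
      ThetaLaw a b c d (z / (4 * z + 1)) (w / (4 * z + 1)) := by
  unfold ThetaLaw
  have hd0 : d ≠ 0 := by rintro rfl; simp at hd
  have hB0 : 4 * z + 1 ≠ 0 := by
    intro h; have := congrArg Complex.im h; simp at this; linarith
  have hzB : 0 < (z / (4 * z + 1)).im := by exact_mod_cast im_div_linear_pos 4 hz
  have hJ0 : (c + 4 * d : ℂ) * z + d ≠ 0 := by
    have := linear_ne_zero_of_im_pos (c := c + 4 * d) (d := d)
      (IsCoprime.add_mul_right_left h 4) hz
    exact_mod_cast this
  have hAB : ((c : ℂ) * (z / (4 * z + 1)) + d) * (4 * z + 1) = (c + 4 * d) * z + d := by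
    rw [add_mul, mul_assoc, div_mul_cancel₀ _ hB0]; ring
  have hA0 : (c : ℂ) * (z / (4 * z + 1)) + d ≠ 0 := fun h => hJ0 (by rw [← hAB, h, zero_mul])
  have hsign := sqrt_cocycle_sign (c := c) (d := d) (A := c * (z / (4 * z + 1)) + d)
    (B := 4 * z + 1) hd0 hz rfl hAB
    (fun hc => by simpa using mul_pos (by exact_mod_cast hc) hzB)
    (fun hc => by simpa using mul_neg_of_neg_of_pos (by exact_mod_cast hc) hzB)
    (fun hc => by simp [hc])
  have hK := congrArg (Int.cast : ℤ → ℂ) (kroneckerSym_add_left c d)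
  have hnum : ((a : ℂ) * (z / (4 * z + 1)) + b) * (4 * z + 1) = (a + 4 * b) * z + b := by
    rw [add_mul, mul_assoc, div_mul_cancel₀ _ hB0]; ring
  rw [jacobiTheta₂_lower_four hz]
  push_cast at hK ⊢
  rw [← hnum, ← hAB, mul_div_mul_right _ _ hB0]
  have hexp : Complex.exp (Real.pi * Complex.I * (c + 4 * d) * w ^ 2 /
      (2 * ((c * (z / (4 * z + 1)) + d) * (4 * z + 1)))) =
      Complex.exp (Real.pi * Complex.I * c * (w / (4 * z + 1)) ^ 2 /
        (2 * (c * (z / (4 * z + 1)) + d))) *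
      Complex.exp (2 * Real.pi * Complex.I * w ^ 2 / (4 * z + 1)) := by
    rw [← Complex.exp_add]
    congr 1
    generalize hA : (c : ℂ) * (z / (4 * z + 1)) + d = A at *
    have hB : (c + 4 * d : ℂ) * (4 * z + 1) = c + 4 * A * (4 * z + 1) := by
      linear_combination -4 * hAB
    generalize (4 * z + 1 : ℂ) = B at *
    field_simp
    linear_combination w ^ 2 * hB
  rw [hexp, div_div, mul_comm (4 * z + 1)]
  generalize (c : ℂ) * (z / (4 * z + 1)) + d = A at *
  generalize (4 * z + 1 : ℂ) = B at *
  have hsK : (kroneckerSym (c + 4 * d) d : ℂ) * (A * B) ^ (1 / 2 : ℂ) =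
      kroneckerSym c d * (A ^ (1 / 2 : ℂ) * B ^ (1 / 2 : ℂ)) := by
    have h1 : (if c < 0 ∧ d < 0 then (-1 : ℂ) else 1) * (if c < 0 ∧ d < 0 then (-1 : ℂ) else 1)
      = 1 := by split_ifs <;> norm_num
    generalize (if c < 0 ∧ d < 0 then (-1 : ℂ) else 1) = s₁ at *
    linear_combination (s₁ * (A * B) ^ (1 / 2 : ℂ)) * hK + s₁ * kroneckerSym c d * hsign +
      (kroneckerSym c d * (A ^ (1 / 2 : ℂ) * B ^ (1 / 2 : ℂ)) -
        kroneckerSym (c + 4 * d) d * (A * B) ^ (1 / 2 : ℂ)) * h1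
  refine Eq.congr_right ?_
  linear_combination ((epsilon d)⁻¹ * Complex.exp (Real.pi * Complex.I * c * (w / B) ^ 2 / (2 * A)) *
    Complex.exp (2 * Real.pi * Complex.I * w ^ 2 / B) * jacobiTheta₂ w (2 * z)) * hsK

theorem thetaLaw_of_c_eq_zero {a b d : ℤ} (h : a * d = 1) (z w : ℂ) : ThetaLaw a b 0 d z w := by
  unfold ThetaLaw
  rcases Int.mul_eq_one_iff_eq_one_or_neg_one.mp h with ⟨rfl, rfl⟩ | ⟨rfl, rfl⟩
  · have := jacobiTheta₂_add_two_mul_int w (2 * z) b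
    simp [kroneckerSym, epsilon, mul_add, this]
  · have := jacobiTheta₂_add_two_mul_int w (2 * z) (-b)
    have hs : (-1 : ℂ) ^ (1 / 2 : ℂ) = Complex.I := by
      rw [Complex.cpow_def_of_ne_zero (by norm_num), Complex.log_neg_one,
        show Real.pi * Complex.I * (1 / 2) = Real.pi / 2 * Complex.I by ring,
        Complex.exp_pi_div_two_mul_I]
    push_cast at this
    have e : (2 : ℂ) * ((((-1 : ℤ) : ℂ) * z + b) / (((0 : ℤ) : ℂ) * z + ((-1 : ℤ) : ℂ))) =
      2 * z + 2 * -b := by push_cast; ring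
    rw [e]
    push_cast
    simp only [zero_mul, zero_add, mul_zero, zero_div, Complex.exp_zero, mul_one, hs, div_neg, this,
      div_one, jacobiTheta₂_neg_left]
    simp [kroneckerSym, epsilon]

/-- Euclidean descent on `|c| + |d|`, ending at `c = 0`. -/
theorem thetaLaw_of_four_dvd (n : ℕ) : ∀ {a b c d : ℤ}, c.natAbs + d.natAbs = n →
    a * d - b * c = 1 → 4 ∣ c → ∀ {z : ℂ}, 0 < z.im → ∀ w : ℂ, ThetaLaw a b c d z w := by
  induction n using Nat.strong_induction_on with
  | _ n ih =>
    intro a b c d hn hdet hc z hz w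
    have hcop : IsCoprime c d := ⟨-b, a, by linear_combination hdet⟩
    have hd : Odd d := by
      by_contra hd
      rw [Int.not_odd_iff_even] at hd
      obtain ⟨x, rfl⟩ := hd
      obtain ⟨y, rfl⟩ := hc
      have : 2 * (a * x - 2 * (b * y)) = 1 := by linear_combination hdet
      omega
    rcases eq_or_ne c 0 with rfl | hc0
    · exact thetaLaw_of_c_eq_zero (by linear_combination hdet) z w
    · have hd0 : d ≠ 0 := by rintro rfl; simp at hd
      rw [Int.odd_iff] at hd
      have htrans : ∀ {z : ℂ}, 0 < z.im → (z - 1).im > 0 ∧ (z + 1).im > 0 := fun h => by simpa using h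
      -- If `|c| < 2|d|`, one of `d ± c` is smaller than `d` in absolute value; if `|c| > 2|d|`, one
      -- of `c ± 4d` is smaller than `c`. Equality is impossible for `d` odd and `4 ∣ c`.
      rcases lt_or_ge (c.natAbs) (2 * d.natAbs) with hlt | hge
      · rcases lt_or_ge (d - c).natAbs d.natAbs with hs | hs
        · have := ih _ (by omega) (a := a) (b := b - a) (c := c) (d := d - c) rfl
            (by linear_combination hdet) hc (htrans hz).2 w
          rw [← thetaLaw_translate hc hc0 (by rw [Int.odd_iff]; omega)] at this
          simpa using this
        · have := ih _ (by omega) (a := a) (b := a + b) (c := c) (d := d + c) rfl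
            (by linear_combination hdet) hc (htrans hz).1 w
          rw [thetaLaw_translate hc hc0 (by rw [Int.odd_iff]; omega)] at this
          simpa using this
      · rcases lt_or_ge (c - 4 * d).natAbs c.natAbs with hs | hs
        · have := ih _ (by omega) (a := a - 4 * b) (b := b) (c := c - 4 * d) (d := d) rfl
            (by linear_combination hdet) (by omega)
            (show 0 < (z / (4 * z + 1)).im by exact_mod_cast im_div_linear_pos 4 hz)
            (w / (4 * z + 1))
          rw [← thetaLaw_lower (by simpa [sub_eq_add_neg] using IsCoprime.add_mul_right_left hcop (-4))
            (Int.odd_iff.mpr hd) hz] at this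
          simpa using this
        -- The law for `(c + 4d, d)` is taken at the preimage of `(z, w)` under the substitution of
        -- `thetaLaw_lower`.
        · have hz' : 0 < (z / (-4 * z + 1)).im := by
            have := im_div_linear_pos (-4) hz
            push_cast at this; exact this
          have := ih _ (by omega) (a := a + 4 * b) (b := b) (c := c + 4 * d) (d := d) rfl
            (by linear_combination hdet) (by omega) hz' (w / (-4 * z + 1))
          rw [thetaLaw_lower hcop (Int.odd_iff.mpr hd) hz'] at this
          have hB : -4 * z + 1 ≠ 0 := by intro h; rw [h] at hz'; simp at hz'
          have e : 4 * (z / (-4 * z + 1)) + 1 = (-4 * z + 1)⁻¹ := by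
            refine eq_inv_of_mul_eq_one_left ?_
            rw [add_mul, mul_assoc, div_mul_cancel₀ _ hB]; ring
          rw [e, div_inv_eq_mul, div_inv_eq_mul, div_mul_cancel₀ _ hB, div_mul_cancel₀ _ hB] at this
          exact this

/-! ### Quasi-periodicity and the law at division points -/

theorem jacobiTheta₂_term_add_mul (n k : ℤ) (w τ : ℂ) :
    jacobiTheta₂_term n (w + k * τ) τ =
      Complex.exp (-Real.pi * Complex.I * (k ^ 2 * τ + 2 * k * w)) *
        jacobiTheta₂_term (n + k) w τ := by
  rw [jacobiTheta₂_term, jacobiTheta₂_term, ← Complex.exp_add]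
  congr 1; push_cast; ring

theorem jacobiTheta₂_add_int_mul (k : ℤ) (w τ : ℂ) :
    jacobiTheta₂ (w + k * τ) τ =
      Complex.exp (-Real.pi * Complex.I * (k ^ 2 * τ + 2 * k * w)) * jacobiTheta₂ w τ := by
  conv_rhs => rw [jacobiTheta₂, ← tsum_mul_left, ← (Equiv.addRight k).tsum_eq]
  exact tsum_congr fun n => jacobiTheta₂_term_add_mul n k w τ

theorem jacobiTheta₂'_add_int_mul (k : ℤ) (w : ℂ) {τ : ℂ} (hτ : 0 < τ.im) :
    jacobiTheta₂' (w + k * τ) τ =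
      Complex.exp (-Real.pi * Complex.I * (k ^ 2 * τ + 2 * k * w)) *
        (jacobiTheta₂' w τ - 2 * Real.pi * Complex.I * k * jacobiTheta₂ w τ) := by
  have h := ((hasSum_jacobiTheta₂'_term w hτ).sub
    ((hasSum_jacobiTheta₂_term w hτ).mul_left (2 * Real.pi * Complex.I * k))).mul_left
    (Complex.exp (-Real.pi * Complex.I * (k ^ 2 * τ + 2 * k * w)))
  rw [← (Equiv.addRight k).hasSum_iff] at h
  rw [jacobiTheta₂', ← h.tsum_eq]
  refine tsum_congr fun n => ?_
  simp only [jacobiTheta₂'_term, jacobiTheta₂_term_add_mul, Function.comp, Equiv.coe_addRight]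
  push_cast; ring

section PointLaw

variable {a b c d : ℤ} {N : ℕ}

/-- The multiplier `(c / d) ε_d⁻¹` of the theta function. -/
def thetaMult (c d : ℤ) : ℂ := kroneckerSym c d * (epsilon d)⁻¹

/-- The Gaussian factor of the theta law and the factor of quasi-periodicity differ by `exp (-2πi c'
u² d)`. This integrality is where `4N² ∣ c` enters. -/
theorem exp_division_point [NeZero N] (u c' d : ℤ) {z J : ℂ} (hJ : J ≠ 0)
    (hJ' : J = (4 * N ^ 2 * c') * z + d) :
    Complex.exp (Real.pi * Complex.I * (4 * N ^ 2 * c') * (J * (u / N)) ^ 2 / (2 * J)) *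
    Complex.exp (-Real.pi * Complex.I *
      ((2 * N * c' * u : ℤ) ^ 2 * (2 * z) + 2 * (2 * N * c' * u : ℤ) * (d * u / N))) = 1 := by
  have hN : (N : ℂ) ≠ 0 := Nat.cast_ne_zero.mpr (NeZero.ne N)
  rw [← Complex.exp_add, Complex.exp_eq_one_iff]
  refine ⟨-(c' * u ^ 2 * d), ?_⟩
  have e : Real.pi * Complex.I * (4 * N ^ 2 * c') * (J * (u / N)) ^ 2 / (2 * J) =
      2 * Real.pi * Complex.I * c' * J * u ^ 2 := by
    field_simp; ring
  rw [e, hJ']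
  push_cast
  field_simp
  ring

theorem division_point_split [NeZero N] (u c' d : ℤ) (z : ℂ) :
    ((4 * N ^ 2 * c') * z + d) * (u / N) = d * u / N + (2 * N * c' * u : ℤ) * (2 * z) := by
  have hN : (N : ℂ) ≠ 0 := Nat.cast_ne_zero.mpr (NeZero.ne N)
  push_cast
  field_simp
  ring

theorem jacobiTheta₂_division_point [NeZero N] (hdet : a * d - b * c = 1) (hc : (4 * N ^ 2 : ℤ) ∣ c)
    {z : ℂ} (hz : 0 < z.im) (u : ℤ) :
    jacobiTheta₂ (u / N) (2 * ((a * z + b) / (c * z + d))) =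
      thetaMult c d * (c * z + d) ^ (1 / 2 : ℂ) * jacobiTheta₂ (d * u / N) (2 * z) := by
  have hJ := linear_ne_zero_of_im_pos (c := c) (d := d) ⟨-b, a, by linear_combination hdet⟩ hz
  have h := thetaLaw_of_four_dvd _ rfl hdet (Dvd.dvd.trans ⟨_, rfl⟩ hc) hz ((c * z + d) * (u / N))
  unfold ThetaLaw at h
  obtain ⟨c', rfl⟩ := hc
  rw [mul_div_cancel_left₀ _ hJ] at h
  rw [h]
  push_cast at hJ ⊢
  have hE := exp_division_point (N := N) u c' d hJ rfl
  conv_lhs => rw [division_point_split (N := N) u c' d z, jacobiTheta₂_add_int_mul,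
    ← division_point_split (N := N) u c' d z]
  unfold thetaMult
  push_cast at hE ⊢
  linear_combination (kroneckerSym (4 * N ^ 2 * c') d * (epsilon d)⁻¹ *
    ((4 * N ^ 2 * c') * z + d) ^ (1 / 2 : ℂ) * jacobiTheta₂ (d * u / N) (2 * z)) * hE

/-- The derivative in `w` of the theta law; the chain rule yields the extra factor `c z + d` that
raises the weight from 1/2 to 3/2. -/
theorem ThetaLaw.deriv (hcop : IsCoprime c d) {z : ℂ} (hz : 0 < z.im)
    (hz' : 0 < ((a * z + b) / (c * z + d)).im) (h : ∀ w, ThetaLaw a b c d z w) (w : ℂ) :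
    jacobiTheta₂' (w / (c * z + d)) (2 * ((a * z + b) / (c * z + d))) =
      thetaMult c d * (c * z + d) ^ (1 / 2 : ℂ) *
        Complex.exp (Real.pi * Complex.I * c * w ^ 2 / (2 * (c * z + d))) *
        (Real.pi * Complex.I * c * w * jacobiTheta₂ w (2 * z) +
          (c * z + d) * jacobiTheta₂' w (2 * z)) := by
  have hJ := linear_ne_zero_of_im_pos hcop hz
  unfold ThetaLaw at h
  generalize (a * z + b) / (c * z + d) = z' at *
  generalize (c : ℂ) * z + d = J at *
  have h1 : HasDerivAt (fun w => jacobiTheta₂ (w / J) (2 * z')) (jacobiTheta₂' (w / J) (2 * z') * (1 / J)) w :=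
    HasDerivAt.comp (h₂ := fun w => jacobiTheta₂ w (2 * z')) w
      (hasDerivAt_jacobiTheta₂_fst (w / J) (by simpa using hz')) ((hasDerivAt_id w).div_const J)
  have h2 : HasDerivAt (fun w : ℂ => Real.pi * Complex.I * c * w ^ 2 / (2 * J))
      (Real.pi * Complex.I * c * (2 * w) / (2 * J)) w := by
    simpa using ((hasDerivAt_pow 2 w).const_mul (Real.pi * Complex.I * c)).div_const (2 * J)
  have h3 := ((h2.cexp).const_mul (kroneckerSym c d * (epsilon d)⁻¹ * J ^ (1 / 2 : ℂ))).mul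
    (hasDerivAt_jacobiTheta₂_fst w (τ := 2 * z) (by simpa using hz))
  have h4 := h1.unique (h3.congr_of_eventuallyEq (Filter.Eventually.of_forall h))
  rw [mul_one_div, div_eq_iff hJ] at h4
  rw [h4]
  unfold thetaMult
  field_simp

theorem jacobiTheta₂'_division_point [NeZero N] (hdet : a * d - b * c = 1)
    (hc : (4 * N ^ 2 : ℤ) ∣ c) {z : ℂ} (hz : 0 < z.im)
    (hz' : 0 < ((a * z + b) / (c * z + d)).im) (u : ℤ) :
    jacobiTheta₂' (u / N) (2 * ((a * z + b) / (c * z + d))) =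
      thetaMult c d * ((c * z + d) ^ (1 / 2 : ℂ)) ^ 3 * jacobiTheta₂' (d * u / N) (2 * z) := by
  have hcop : IsCoprime c d := ⟨-b, a, by linear_combination hdet⟩
  have hJ := linear_ne_zero_of_im_pos hcop hz
  have hN : (N : ℂ) ≠ 0 := Nat.cast_ne_zero.mpr (NeZero.ne N)
  have h := ThetaLaw.deriv hcop hz hz'
    (fun w => thetaLaw_of_four_dvd _ rfl hdet (Dvd.dvd.trans ⟨_, rfl⟩ hc) hz w)
    ((c * z + d) * (u / N))
  obtain ⟨c', rfl⟩ := hc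
  rw [mul_div_cancel_left₀ _ hJ] at h
  rw [h, pow_succ (_ ^ (1 / 2 : ℂ)), sqrt_sq]
  push_cast at hJ ⊢
  have hE := exp_division_point (N := N) u c' d hJ rfl
  set E₁ := Complex.exp (Real.pi * Complex.I * (4 * N ^ 2 * c') *
    (((4 * N ^ 2 * c') * z + d) * (u / N)) ^ 2 / (2 * ((4 * N ^ 2 * c') * z + d))) with hE₁
  rw [division_point_split (N := N) u c' d z, jacobiTheta₂_add_int_mul, jacobiTheta₂'_add_int_mul _ _ (by simpa using hz),
    ← division_point_split (N := N) u c' d z]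
  set E₂ := Complex.exp (-Real.pi * Complex.I *
      ((2 * N * c' * u : ℤ) ^ 2 * (2 * z) + 2 * (2 * N * c' * u : ℤ) * (d * u / N)))
  -- At `w = J u / N` the identity `c w = 2 k J`, with shift `k = 2 N c' u`, makes the two terms
  -- containing the underived theta cancel.
  have e : (4 * N ^ 2 * c' : ℂ) * (((4 * N ^ 2 * c') * z + d) * (u / N)) =
    ((4 * N ^ 2 * c') * z + d) * (4 * N * c' * u) := by field_simp
  have e' : Real.pi * Complex.I * (4 * N ^ 2 * c' : ℂ) * (((4 * N ^ 2 * c') * z + d) * (u / N)) =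
    Real.pi * Complex.I * (((4 * N ^ 2 * c') * z + d) * (4 * N * c' * u)) := by rw [mul_assoc, e]
  have hk : ((2 * N * c' * u : ℤ) : ℂ) = 2 * N * c' * u := by push_cast; ring
  rw [e', hk]
  linear_combination (thetaMult (4 * N ^ 2 * c') d *
    ((4 * N ^ 2 * c') * z + d) ^ (1 / 2 : ℂ) * ((4 * N ^ 2 * c') * z + d) * jacobiTheta₂' (d * u / N) (2 * z)) * hE

end PointLaw

/-! ### Theta series with characters and Gauss sums -/

theorem hasSum_nat_of_even {f : ℤ → ℂ} (hf : Summable f) (he : ∀ n, f (-n) = f n) :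
    HasSum f (2 * (∑' n : ℕ, (f n - if n = 0 then f 0 / 2 else 0))) := by
  have h1 : Summable (fun n : ℕ => f n) := hf.comp_injective Nat.cast_injective
  have h2 : HasSum (fun n : ℕ => f (-(n + 1))) (∑' n : ℕ, f n - f 0) := by
    have := (hasSum_nat_add_iff' 1).mpr h1.hasSum
    simp only [Finset.sum_range_one, Nat.cast_zero] at this
    exact this.congr_fun fun n => by rw [he]; push_cast; rfl
  have h3 := h1.hasSum.of_nat_of_neg_add_one h2
  have h4 := (h1.hasSum.sub (hasSum_ite_eq 0 (f 0 / 2))).tsum_eq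
  convert h3 using 1
  rw [h4]; ring

/-- The term `e^{2πi n² z}` of the theta series. -/
def thetaExp (n : ℤ) (z : ℂ) : ℂ := Complex.exp (2 * Real.pi * Complex.I * (n : ℂ) ^ 2 * z)

theorem jacobiTheta₂_term_two_mul (n : ℤ) (w z : ℂ) :
    jacobiTheta₂_term n w (2 * z) = Complex.exp (2 * Real.pi * Complex.I * n * w) * thetaExp n z := by
  rw [jacobiTheta₂_term, thetaExp, ← Complex.exp_add]; congr 1; ring

theorem summable_thetaExp {z : ℂ} (hz : 0 < z.im) : Summable (fun n => thetaExp n z) := by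
  have := (summable_jacobiTheta₂_term_iff 0 (2 * z)).mpr (by simpa using hz)
  simpa [jacobiTheta₂_term_two_mul] using this

theorem summable_mul_thetaExp {z : ℂ} (hz : 0 < z.im) : Summable (fun n : ℤ => n * thetaExp n z) := by
  have := ((summable_jacobiTheta₂'_term_iff 0 (2 * z)).mpr (by simpa using hz)).mul_left
    (2 * Real.pi * Complex.I)⁻¹
  refine this.congr fun n => ?_
  rw [jacobiTheta₂'_term, jacobiTheta₂_term_two_mul]
  have : (Real.pi : ℂ) ≠ 0 := Complex.ofReal_ne_zero.mpr Real.pi_ne_zero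
  rw [mul_zero, Complex.exp_zero]
  field_simp [Complex.I_ne_zero]

theorem norm_thetaExp (n : ℤ) (z : ℂ) :
    ‖thetaExp n z‖ = Real.exp (-(2 * Real.pi * n ^ 2 * z.im)) := by
  rw [thetaExp, Complex.norm_exp]
  congr 1
  rw [show 2 * Real.pi * Complex.I * (n : ℂ) ^ 2 * z = ((2 * Real.pi * n ^ 2 : ℝ) : ℂ) * (Complex.I * z) by
    push_cast; ring, Complex.re_ofReal_mul]
  simp

/-- A series `∑ a_n e^{2πi n² z}` with normally convergent terms is holomorphic. -/
theorem differentiableOn_tsum_thetaExp {ι : Type*} (e : ι → ℤ) {a : ι → ℂ}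
    (ha : ∀ {z : ℂ}, 0 < z.im → Summable (fun n => a n * thetaExp (e n) z)) :
    DifferentiableOn ℂ (fun z => ∑' n, a n * thetaExp (e n) z) {z : ℂ | 0 < z.im} := by
  intro z hz
  have hT : 0 < z.im / 2 := half_pos hz
  have ho : IsOpen {w : ℂ | z.im / 2 < w.im} := isOpen_lt continuous_const Complex.continuous_im
  -- On the half-plane of points with imaginary part above `Im z / 2`, each term is dominated by its
  -- absolute value at `i Im z / 2`.
  have hs := (ha (z := ((z.im / 2 : ℝ) : ℂ) * Complex.I) (by simpa using hz)).norm
  refine ((Complex.differentiableOn_tsum_of_summable_norm hs (fun i => ?_) ho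
    (fun i w hw => ?_)).differentiableAt (ho.mem_nhds (by simpa using hz))).differentiableWithinAt
  · unfold thetaExp; fun_prop
  · rw [norm_mul, norm_mul, norm_thetaExp, norm_thetaExp]
    refine mul_le_mul_of_nonneg_left (Real.exp_le_exp.mpr (neg_le_neg ?_)) (norm_nonneg _)
    refine mul_le_mul_of_nonneg_left ?_ (by positivity)
    simpa using (show z.im / 2 < w.im from hw).le

section ThetaSeries

variable {N : ℕ} {ψ : DirichletCharacter ℂ N}

theorem summable_char_mul_thetaExp (ψ : DirichletCharacter ℂ N) {z : ℂ} (hz : 0 < z.im) :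
    Summable (fun n : ℤ => ψ n * thetaExp n z) :=
  (summable_thetaExp hz).norm.of_norm_bounded fun n => by
    rw [norm_mul]
    exact mul_le_of_le_one_left (norm_nonneg _) (DirichletCharacter.norm_le_one ψ _)

theorem summable_mul_char_mul_thetaExp (ψ : DirichletCharacter ℂ N) {z : ℂ} (hz : 0 < z.im) :
    Summable (fun n : ℤ => n * ψ n * thetaExp n z) :=
  (summable_mul_thetaExp hz).norm.of_norm_bounded fun n => by
    rw [norm_mul, norm_mul, norm_mul, mul_assoc]
    refine mul_le_mul_of_nonneg_left ?_ (norm_nonneg _)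
    exact mul_le_of_le_one_left (norm_nonneg _) (DirichletCharacter.norm_le_one ψ _)

theorem char_zero_of_eq_one [NeZero N] (hprim : ψ.IsPrimitive) (h : ψ = 1) : ψ 0 = 1 := by
  have : N = 1 := by
    subst h
    rw [← hprim, DirichletCharacter.conductor_one]
  subst this
  rw [Subsingleton.elim (0 : ZMod 1) 1, map_one]

theorem char_zero_of_ne_one (h : ψ ≠ 1) : ψ 0 = 0 := by
  refine MulChar.map_nonunit ψ fun h0 => h ?_
  rw [isUnit_zero_iff] at h0
  have : Subsingleton (ZMod N) := subsingleton_of_zero_eq_one h0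
  ext u
  rw [Subsingleton.elim u 1]
  simp

/-- Halving the two-sided series halves the term of `n = 0`. A trivial primitive character has
modulus 1 and `ψ 0 = 1`, whence the value 1/2; otherwise `ψ 0 = 0`. -/
theorem hasSum_theta0 [NeZero N] (hprim : ψ.IsPrimitive) (heven : ψ.Even) (z : ℍ) :
    HasSum (fun n : ℤ => ψ n * thetaExp n z) (2 * theta0 ψ z) := by
  convert hasSum_nat_of_even (summable_char_mul_thetaExp ψ z.im_pos) (fun n => ?_) using 2
  · unfold theta0
    refine tsum_congr fun n => ?_
    rcases Nat.eq_zero_or_pos n with rfl | hn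
    · by_cases h : ψ = 1
      · have := char_zero_of_eq_one hprim h
        simp only [true_and, if_pos h, if_true, Nat.cast_zero, Int.cast_zero, this]
        simp [thetaExp]
        norm_num
      · simp [thetaExp, char_zero_of_ne_one h, h]
    · simp [hn.ne', thetaExp]
  · simp only [Int.cast_neg, heven.eval_neg]
    simp [thetaExp]

theorem hasSum_theta1 (hodd : ψ.Odd) (z : ℍ) :
    HasSum (fun n : ℤ => n * ψ n * thetaExp n z) (2 * theta1 ψ z) := by
  convert hasSum_nat_of_even (summable_mul_char_mul_thetaExp ψ z.im_pos) (fun n => ?_) using 2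
  · unfold theta1
    refine tsum_congr fun n => ?_
    simp [thetaExp]
  · simp only [Int.cast_neg, hodd.eval_neg]
    simp [thetaExp]

theorem isSmooth_theta0 [NeZero N] (hprim : ψ.IsPrimitive) (heven : ψ.Even) : IsSmooth (theta0 ψ) :=
  isSmooth_of_differentiableOn
    (F := fun z => 2⁻¹ * ∑' n : ℤ, ψ n * thetaExp n z)
    (fun z => by simp [(hasSum_theta0 hprim heven z).tsum_eq])
    ((differentiableOn_tsum_thetaExp id (summable_char_mul_thetaExp ψ)).const_mul _)

theorem isSmooth_theta1 (hodd : ψ.Odd) : IsSmooth (theta1 ψ) :=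
  isSmooth_of_differentiableOn
    (F := fun z => 2⁻¹ * ∑' n : ℤ, n * ψ n * thetaExp n z)
    (fun z => by simp [(hasSum_theta1 hodd z).tsum_eq])
    ((differentiableOn_tsum_thetaExp id (summable_mul_char_mul_thetaExp ψ)).const_mul _)

theorem inv_eq_self_of_isRealChar (h : IsRealChar ψ) (a : ZMod N) : ψ⁻¹ a = ψ a := by
  rw [← MulChar.star_apply', Complex.star_def, Complex.conj_eq_iff_im]
  exact h a

/-- The Fourier transform of a primitive `ψ` is a multiple of its Gauss sum, and the transform is
injective. -/
theorem tau_ne_zero [NeZero N] (hprim : ψ.IsPrimitive) : tau ψ ≠ 0 := by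
  intro h
  have h1 : ZMod.dft ψ = 0 := by
    ext k
    rw [hprim.fourierTransform_eq_inv_mul_gaussSum, show gaussSum ψ ZMod.stdAddChar = 0 from h]
    simp
  have h2 := congrFun ((LinearEquiv.map_eq_zero_iff _).mp h1) 1
  simp at h2

theorem sum_zmod_eq_sum_fin [NeZero N] (F : ZMod N → ℂ) : ∑ u, F u = ∑ j : Fin N, F ((j : ℕ) : ZMod N) := by
  symm
  refine Fintype.sum_bijective (fun j : Fin N => ((j : ℕ) : ZMod N)) ?_ _ _ (fun _ => rfl)
  rw [Fintype.bijective_iff_injective_and_card]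
  refine ⟨fun i j h => ?_, by simp⟩
  have := congrArg ZMod.val h
  simp only [ZMod.val_natCast_of_lt i.2, ZMod.val_natCast_of_lt j.2] at this
  exact Fin.ext this

theorem sum_char_mul_exp [NeZero N] (hprim : ψ.IsPrimitive) (hreal : IsRealChar ψ) (d n : ℤ) :
    ∑ j : Fin N, ψ (j : ℕ) * Complex.exp (2 * Real.pi * Complex.I * n * (d * (j : ℕ) / N)) =
      ψ d * tau ψ * ψ n := by
  have h := gaussSum_mulShift_of_isPrimitive (e := ZMod.stdAddChar) hprim ((n * d : ℤ) : ZMod N)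
  rw [inv_eq_self_of_isRealChar hreal, gaussSum, sum_zmod_eq_sum_fin] at h
  push_cast at h
  rw [map_mul] at h
  rw [show ψ d * tau ψ * ψ n = ψ n * ψ d * gaussSum ψ ZMod.stdAddChar by rw [tau]; ring, ← h]
  refine Finset.sum_congr rfl fun j _ => ?_
  rw [AddChar.mulShift_apply]
  have := ZMod.stdAddChar_coe (N := N) (n * d * (j : ℕ) : ℤ)
  push_cast at this
  rw [this]
  congr 2; ring

theorem sum_char_jacobiTheta₂ [NeZero N] (hprim : ψ.IsPrimitive) (hreal : IsRealChar ψ) (heven : ψ.Even)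
    (d : ℤ) (z : ℍ) :
    ∑ j : Fin N, ψ (j : ℕ) * jacobiTheta₂ (d * (j : ℕ) / N) (2 * z) =
      ψ d * tau ψ * (2 * theta0 ψ z) := by
  have h1 := hasSum_sum (s := (Finset.univ : Finset (Fin N))) fun j _ =>
    (hasSum_jacobiTheta₂_term (d * (j : ℕ) / N) (τ := 2 * z) (by simpa using z.im_pos)).mul_left
      (ψ ((j : ℕ) : ZMod N))
  refine h1.unique (((hasSum_theta0 hprim heven z).mul_left (ψ d * tau ψ)).congr_fun fun n => ?_)
  simp only [jacobiTheta₂_term_two_mul, ← mul_assoc]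
  rw [← Finset.sum_mul, ← sum_char_mul_exp hprim hreal]

theorem sum_char_jacobiTheta₂' [NeZero N] (hprim : ψ.IsPrimitive) (hreal : IsRealChar ψ)
    (hodd : ψ.Odd) (d : ℤ) (z : ℍ) :
    ∑ j : Fin N, ψ (j : ℕ) * jacobiTheta₂' (d * (j : ℕ) / N) (2 * z) =
      ψ d * tau ψ * (2 * Real.pi * Complex.I * (2 * theta1 ψ z)) := by
  have h1 := hasSum_sum (s := (Finset.univ : Finset (Fin N))) fun j _ =>
    (hasSum_jacobiTheta₂'_term (d * (j : ℕ) / N) (τ := 2 * z) (by simpa using z.im_pos)).mul_left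
      (ψ ((j : ℕ) : ZMod N))
  refine h1.unique ((((hasSum_theta1 hodd z).mul_left (2 * Real.pi * Complex.I)).mul_left
    (ψ d * tau ψ)).congr_fun fun n => ?_)
  have h2 : ∀ j : Fin N, ψ (j : ℕ) * jacobiTheta₂'_term n (d * (j : ℕ) / N) (2 * z) =
      (ψ (j : ℕ) * Complex.exp (2 * Real.pi * Complex.I * n * (d * (j : ℕ) / N))) *
        (2 * Real.pi * Complex.I * n * thetaExp n z) := fun j => by
    rw [jacobiTheta₂'_term, jacobiTheta₂_term_two_mul]; ring
  simp only [h2]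
  rw [← Finset.sum_mul, sum_char_mul_exp hprim hreal]
  ring

theorem coe_moebius_eq {a b c d : ℤ} {γ : SL(2, ℝ)} (ha : γ 0 0 = a) (hb : γ 0 1 = b)
    (hc : γ 1 0 = c) (hd : γ 1 1 = d) (z : ℍ) :
    ((γ • z : ℍ) : ℂ) = (a * z + b) / (c * z + d) := by
  rw [coe_sl_smul, autFactor, ha, hb, hc, hd]; push_cast; rfl

/-- The theta law replaces the division point `j / N` by `d j / N`; in the Gauss sum expansion this
multiplies the series by `ψ d`, and `τ(ψ) ≠ 0` can be cancelled. -/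
theorem theta0_smul [NeZero N] (hprim : ψ.IsPrimitive) (hreal : IsRealChar ψ) (heven : ψ.Even)
    {a b c d : ℤ} {γ : SL(2, ℝ)} (ha : γ 0 0 = a) (hb : γ 0 1 = b)
    (hc : γ 1 0 = c) (hd : γ 1 1 = d) (hdet : a * d - b * c = 1) (hdvd : (4 * N ^ 2 : ℤ) ∣ c)
    (z : ℍ) :
    theta0 ψ (γ • z) = ψ d * thetaMult c d * sqrtAut γ z * theta0 ψ z := by
  have h1 := sum_char_jacobiTheta₂ hprim hreal heven 1 (γ • z)
  have h2 := sum_char_jacobiTheta₂ hprim hreal heven d z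
  have h3 : ∀ j : Fin N, ψ (j : ℕ) * jacobiTheta₂ ((1 : ℤ) * (j : ℕ) / N) (2 * (γ • z : ℍ)) =
      thetaMult c d * sqrtAut γ z * (ψ (j : ℕ) * jacobiTheta₂ (d * (j : ℕ) / N) (2 * z)) := fun j => by
    have := jacobiTheta₂_division_point hdet hdvd z.im_pos (j : ℕ)
    push_cast at this
    rw [coe_moebius_eq ha hb hc hd, Int.cast_one, one_mul, this, sqrtAut, autFactor, hc, hd]
    push_cast
    ring
  simp only [h3] at h1
  rw [← Finset.mul_sum, h2] at h1
  have := tau_ne_zero hprim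
  rw [Int.cast_one, map_one] at h1
  refine mul_left_cancel₀ (mul_ne_zero two_ne_zero this) ?_
  linear_combination -h1

theorem theta1_smul [NeZero N] (hprim : ψ.IsPrimitive) (hreal : IsRealChar ψ) (hodd : ψ.Odd)
    {a b c d : ℤ} {γ : SL(2, ℝ)} (ha : γ 0 0 = a) (hb : γ 0 1 = b)
    (hc : γ 1 0 = c) (hd : γ 1 1 = d) (hdet : a * d - b * c = 1) (hdvd : (4 * N ^ 2 : ℤ) ∣ c)
    (z : ℍ) :
    theta1 ψ (γ • z) = ψ d * thetaMult c d * sqrtAut γ z ^ 3 * theta1 ψ z := by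
  have h1 := sum_char_jacobiTheta₂' hprim hreal hodd 1 (γ • z)
  have h2 := sum_char_jacobiTheta₂' hprim hreal hodd d z
  have h3 : ∀ j : Fin N, ψ (j : ℕ) * jacobiTheta₂' ((1 : ℤ) * (j : ℕ) / N) (2 * (γ • z : ℍ)) =
      thetaMult c d * sqrtAut γ z ^ 3 *
        (ψ (j : ℕ) * jacobiTheta₂' (d * (j : ℕ) / N) (2 * z)) := fun j => by
    have him := (γ • z).im_pos
    rw [← UpperHalfPlane.coe_im, coe_moebius_eq ha hb hc hd] at him
    have := jacobiTheta₂'_division_point hdet hdvd z.im_pos him (j : ℕ)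
    push_cast at this
    rw [coe_moebius_eq ha hb hc hd, Int.cast_one, one_mul, this, sqrtAut, autFactor, hc, hd]
    push_cast
    ring
  simp only [h3] at h1
  rw [← Finset.mul_sum, h2] at h1
  have := tau_ne_zero hprim
  rw [Int.cast_one, map_one] at h1
  have hpi : (2 * Real.pi * Complex.I : ℂ) ≠ 0 := Complex.two_pi_I_ne_zero
  refine mul_left_cancel₀ (mul_ne_zero hpi (mul_ne_zero two_ne_zero this)) ?_
  linear_combination -h1

end ThetaSeries

/-! ### The Fricke involution -/

theorem sum_residues_eq {N : ℕ} [NeZero N] {F : ℤ → ℂ} {S : ℂ} (h : HasSum F S) {g : Fin N → ℂ}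
    (hg : ∀ j : Fin N, HasSum (fun n : ℤ => F (n * N + (j : ℕ))) (g j)) : ∑ j, g j = S := by
  have h1 := (Int.divModEquiv N).symm.hasSum_iff.mpr h
  have h2 := (Equiv.prodComm (Fin N) ℤ).hasSum_iff.mpr h1
  have h3 := h2.prod_fiberwise (g := g) fun j => (hg j).congr_fun fun n => by
    simp [Function.comp]
  exact (hasSum_fintype g).unique h3

section Fricke

variable {N : ℕ} [NeZero N] {ψ : DirichletCharacter ℂ N}

/-- The constant `√(-iN)` in the Fricke transformation law of theta series. -/
def frickeConst (N : ℕ) : ℂ := (-Complex.I * N) ^ (1 / 2 : ℂ)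

/-- The roots of `2 N z` and `-i N` lie in the first and the fourth quadrant, so their product has
positive real part and is the principal root of the product. -/
theorem fricke_sqrt {z z' : ℂ} (hz : 0 < z.im) (h : z' = -1 / (4 * N ^ 2 * z)) :
    1 / (-Complex.I * (2 * z')) ^ (1 / 2 : ℂ) = frickeConst N * (2 * N * z) ^ (1 / 2 : ℂ) := by
  have hN : (0 : ℝ) < N := Nat.cast_pos.mpr (NeZero.pos N)
  have hN0 : (N : ℂ) ≠ 0 := Nat.cast_ne_zero.mpr (NeZero.ne N)
  have hz0 : z ≠ 0 := by rintro rfl; simp at hz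
  have e1 : -Complex.I * (2 * z') = (2 * N * z * (-Complex.I * N))⁻¹ := by
    rw [h]; field_simp; ring_nf; simp
  have him : 0 < (2 * N * z : ℂ).im := by
    have : (2 * N * z : ℂ) = ((2 * N : ℝ) : ℂ) * z := by push_cast; ring
    rw [this, Complex.im_ofReal_mul]; positivity
  have hre : 0 < (2 * N * z * (-Complex.I * N) : ℂ).re := by
    have : (2 * N * z * (-Complex.I * N) : ℂ) = ((2 * N ^ 2 : ℝ) : ℂ) * (-Complex.I * z) := by
      push_cast; ring
    rw [this, Complex.re_ofReal_mul]
    simp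
    positivity
  have hQi : ((-Complex.I * N : ℂ) ^ (1 / 2 : ℂ)).im < 0 := sqrt_im_neg (by simpa using hN)
  have hQr : 0 < ((-Complex.I * N : ℂ) ^ (1 / 2 : ℂ)).re :=
    sqrt_re_pos (Or.inl (by simpa using hN.ne'))
  rw [e1, Complex.inv_cpow _ _ (by
    rw [Ne, Complex.arg_eq_pi_iff]; intro h; linarith [h.1]), one_div, inv_inv,
    sqrt_mul_of_re_pos (sqrt_re_pos (Or.inr hre)), frickeConst, mul_comm]
  rw [Complex.mul_re]
  have := sqrt_re_pos (Or.inl him.ne')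
  have := sqrt_im_pos (Or.inl him)
  nlinarith

theorem fricke_thetaExp {N : ℕ} (j n : ℤ) (z : ℂ) :
    Complex.exp (2 * Real.pi * Complex.I * j ^ 2 * z) *
      jacobiTheta₂_term n (2 * N * j * z) (2 * (N ^ 2 * z)) = thetaExp (n * N + j) z := by
  rw [jacobiTheta₂_term, thetaExp, ← Complex.exp_add]
  congr 1; push_cast; ring

variable {z z' : ℂ}

theorem fricke_args (hz : 0 < z.im) (h : z' = -1 / (4 * N ^ 2 * z)) (j : ℂ) :
    j / N / (2 * z') = -(2 * N * j * z) ∧ -1 / (2 * z') = 2 * (N ^ 2 * z) ∧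
      -Real.pi * Complex.I * (j / N) ^ 2 / (2 * z') = 2 * Real.pi * Complex.I * j ^ 2 * z := by
  have hN0 : (N : ℂ) ≠ 0 := Nat.cast_ne_zero.mpr (NeZero.ne N)
  have hz0 : z ≠ 0 := by rintro rfl; simp at hz
  subst h
  refine ⟨?_, ?_, ?_⟩ <;> field_simp <;> ring

theorem jacobiTheta₂_fricke (hz : 0 < z.im) (h : z' = -1 / (4 * N ^ 2 * z)) (j : ℂ) :
    jacobiTheta₂ (j / N) (2 * z') = frickeConst N * (2 * N * z) ^ (1 / 2 : ℂ) *
      (Complex.exp (2 * Real.pi * Complex.I * j ^ 2 * z) *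
        jacobiTheta₂ (2 * N * j * z) (2 * (N ^ 2 * z))) := by
  obtain ⟨e1, e2, e3⟩ := fricke_args hz h j
  rw [jacobiTheta₂_functional_equation, e1, e2, e3, fricke_sqrt hz h, jacobiTheta₂_neg_left]
  ring

theorem jacobiTheta₂'_fricke (hz : 0 < z.im) (h : z' = -1 / (4 * N ^ 2 * z)) (j : ℂ) :
    jacobiTheta₂' (j / N) (2 * z') = frickeConst N * ((2 * N * z) ^ (1 / 2 : ℂ)) ^ 3 *
      (Complex.exp (2 * Real.pi * Complex.I * j ^ 2 * z) *
        (N * jacobiTheta₂' (2 * N * j * z) (2 * (N ^ 2 * z)) +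
          2 * Real.pi * Complex.I * j * jacobiTheta₂ (2 * N * j * z) (2 * (N ^ 2 * z)))) := by
  obtain ⟨e1, e2, e3⟩ := fricke_args hz h j
  have hN0 : (N : ℂ) ≠ 0 := Nat.cast_ne_zero.mpr (NeZero.ne N)
  have hz0 : z ≠ 0 := by rintro rfl; simp at hz
  have e4 : ∀ x : ℂ, x / (2 * z') = -(2 * N ^ 2 * z) * x := fun x => by
    subst h; field_simp; ring
  rw [jacobiTheta₂'_functional_equation, e1, e2, e3, fricke_sqrt hz h, jacobiTheta₂_neg_left,
    jacobiTheta₂'_neg_left, pow_succ (_ ^ (1 / 2 : ℂ)), sqrt_sq, e4]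
  field_simp
  ring

/-- The functional equation turns the value at `j / N` into the partial series over `n ≡ j` modulo
`N`; weighted by `ψ j`, these reassemble to `θ₀`. -/
theorem theta0_fricke (hprim : ψ.IsPrimitive) (hreal : IsRealChar ψ) (heven : ψ.Even)
    {z z' : ℍ} (h : (z' : ℂ) = -1 / (4 * N ^ 2 * z)) :
    theta0 ψ z' = frickeConst N / tau ψ * (2 * N * z : ℂ) ^ (1 / 2 : ℂ) * theta0 ψ z := by
  have h1 := sum_char_jacobiTheta₂ hprim hreal heven 1 z'
  have hz2 : 0 < (2 * ((N : ℂ) ^ 2 * z)).im := by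
    have hN : (0 : ℝ) < N := Nat.cast_pos.mpr (NeZero.pos N)
    have : (2 * ((N : ℂ) ^ 2 * z)) = ((2 * N ^ 2 : ℝ) : ℂ) * z := by push_cast; ring
    rw [this, Complex.im_ofReal_mul]
    have := z.im_pos
    rw [UpperHalfPlane.coe_im]; positivity
  have h2 := sum_residues_eq (hasSum_theta0 hprim heven z) (g := fun j : Fin N => ψ (j : ℕ) *
      (Complex.exp (2 * Real.pi * Complex.I * (j : ℕ) ^ 2 * z) *
        jacobiTheta₂ (2 * N * (j : ℕ) * z) (2 * (N ^ 2 * z)))) fun j =>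
    (((hasSum_jacobiTheta₂_term _ hz2).mul_left _).mul_left _).congr_fun fun n => by
      rw [← fricke_thetaExp]; simp
  have h3 : ∀ j : Fin N, ψ (j : ℕ) * jacobiTheta₂ ((1 : ℤ) * (j : ℕ) / N) (2 * z') =
      frickeConst N * (2 * N * z : ℂ) ^ (1 / 2 : ℂ) * (ψ (j : ℕ) *
      (Complex.exp (2 * Real.pi * Complex.I * (j : ℕ) ^ 2 * z) *
        jacobiTheta₂ (2 * N * (j : ℕ) * z) (2 * (N ^ 2 * z)))) := fun j => by
    rw [Int.cast_one, one_mul, jacobiTheta₂_fricke z.im_pos h]; ring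
  simp only [h3] at h1
  rw [← Finset.mul_sum, h2, Int.cast_one, map_one] at h1
  have := tau_ne_zero hprim
  field_simp
  linear_combination -h1 / 2

theorem theta1_fricke (hprim : ψ.IsPrimitive) (hreal : IsRealChar ψ) (hodd : ψ.Odd)
    {z z' : ℍ} (h : (z' : ℂ) = -1 / (4 * N ^ 2 * z)) :
    theta1 ψ z' = frickeConst N / tau ψ * ((2 * N * z : ℂ) ^ (1 / 2 : ℂ)) ^ 3 * theta1 ψ z := by
  have h1 := sum_char_jacobiTheta₂' hprim hreal hodd 1 z'
  have hz2 : 0 < (2 * ((N : ℂ) ^ 2 * z)).im := by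
    have hN : (0 : ℝ) < N := Nat.cast_pos.mpr (NeZero.pos N)
    have : (2 * ((N : ℂ) ^ 2 * z)) = ((2 * N ^ 2 : ℝ) : ℂ) * z := by push_cast; ring
    rw [this, Complex.im_ofReal_mul]
    have := z.im_pos
    rw [UpperHalfPlane.coe_im]; positivity
  have h2 := sum_residues_eq ((hasSum_theta1 hodd z).mul_left (2 * Real.pi * Complex.I))
    (g := fun j : Fin N => ψ (j : ℕ) *
      (Complex.exp (2 * Real.pi * Complex.I * (j : ℕ) ^ 2 * z) *
        (N * jacobiTheta₂' (2 * N * (j : ℕ) * z) (2 * (N ^ 2 * z)) +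
          2 * Real.pi * Complex.I * (j : ℕ) *
            jacobiTheta₂ (2 * N * (j : ℕ) * z) (2 * (N ^ 2 * z))))) fun j =>
    (((((hasSum_jacobiTheta₂'_term _ hz2).mul_left _).add
      ((hasSum_jacobiTheta₂_term _ hz2).mul_left _)).mul_left _).mul_left _).congr_fun fun n => by
      rw [← fricke_thetaExp, jacobiTheta₂'_term]
      push_cast
      simp
      ring
  have h3 : ∀ j : Fin N, ψ (j : ℕ) * jacobiTheta₂' ((1 : ℤ) * (j : ℕ) / N) (2 * z') =
      frickeConst N * ((2 * N * z : ℂ) ^ (1 / 2 : ℂ)) ^ 3 * (ψ (j : ℕ) *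
      (Complex.exp (2 * Real.pi * Complex.I * (j : ℕ) ^ 2 * z) *
        (N * jacobiTheta₂' (2 * N * (j : ℕ) * z) (2 * (N ^ 2 * z)) +
          2 * Real.pi * Complex.I * (j : ℕ) *
            jacobiTheta₂ (2 * N * (j : ℕ) * z) (2 * (N ^ 2 * z))))) := fun j => by
    rw [Int.cast_one, one_mul, jacobiTheta₂'_fricke z.im_pos h]; ring
  simp only [h3] at h1
  rw [← Finset.mul_sum, h2, Int.cast_one, map_one] at h1
  have := tau_ne_zero hprim
  have hpi : (2 * Real.pi * Complex.I : ℂ) ≠ 0 := Complex.two_pi_I_ne_zero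
  refine mul_left_cancel₀ (mul_ne_zero hpi this) ?_
  have e := (div_mul_cancel₀ (frickeConst N) this).symm
  generalize frickeConst N / tau ψ = A at *
  rw [e] at h1
  linear_combination -h1 / 2

end Fricke

theorem autFactor_frickeMatrix (M : ℕ) [NeZero M] (z : ℍ) :
    autFactor (frickeMatrix M) z = (√(M : ℝ) : ℂ) * z := by
  simp [autFactor, frickeMatrix]

theorem coe_frickeMatrix_smul (M : ℕ) [NeZero M] (z : ℍ) :
    ((frickeMatrix M • z : ℍ) : ℂ) = -1 / (M * z) := by
  have h0 : (√(M : ℝ) : ℂ) ≠ 0 := by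
    simpa using NeZero.ne M
  have h1 : (√(M : ℝ) : ℂ) * (√(M : ℝ) : ℂ) = M := by
    rw [← Complex.ofReal_mul, Real.mul_self_sqrt (Nat.cast_nonneg M)]; simp
  rw [coe_sl_smul, autFactor_frickeMatrix, ← h1]
  simp [frickeMatrix]
  field_simp

theorem sqrt_four_mul_sq (N : ℕ) : √((4 * N ^ 2 : ℕ) : ℝ) = 2 * N := by
  push_cast
  rw [show (4 * (N : ℝ) ^ 2) = (2 * N) ^ 2 by ring, Real.sqrt_sq (by positivity)]

/-- The two Fricke constants satisfy `A₀² = -A₁²`, by evaluation at the fixed point of `W`. -/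
theorem theta_fricke_const_sq {N : ℕ} [NeZero N] {ψ₀ ψ₁ : DirichletCharacter ℂ N}
    (hprim₀ : ψ₀.IsPrimitive) (hreal₀ : IsRealChar ψ₀) (heven : ψ₀.Even)
    (hprim₁ : ψ₁.IsPrimitive) (hreal₁ : IsRealChar ψ₁) (hodd : ψ₁.Odd)
    (hθ₀ : ∀ z : ℍ, theta0 ψ₀ z ≠ 0) (hθ₁ : ∀ z : ℍ, theta1 ψ₁ z ≠ 0) :
    (frickeConst N / tau ψ₀) ^ 2 = -(frickeConst N / tau ψ₁) ^ 2 := by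
  have hN : (0 : ℝ) < N := Nat.cast_pos.mpr (NeZero.pos N)
  have hN0 : (N : ℂ) ≠ 0 := Nat.cast_ne_zero.mpr (NeZero.ne N)
  let z : ℍ := ⟨((2 * N : ℝ)⁻¹ : ℝ) * Complex.I, by
    rw [Complex.im_ofReal_mul, Complex.I_im, mul_one]; positivity⟩
  have hz : (z : ℂ) = (2 * N : ℂ)⁻¹ * Complex.I := by
    change (((2 * N : ℝ)⁻¹ : ℝ) : ℂ) * Complex.I = _
    push_cast; rfl
  have hfix : (z : ℂ) = -1 / (4 * N ^ 2 * z) := by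
    rw [hz]
    field_simp
    rw [Complex.I_sq]; ring
  have hs : ((2 * N * z : ℂ) ^ (1 / 2 : ℂ)) ^ 2 = Complex.I := by
    rw [sqrt_sq, hz]; field_simp
  have h₀ := theta0_fricke hprim₀ hreal₀ heven hfix
  have h₁ := theta1_fricke hprim₁ hreal₁ hodd hfix
  generalize (2 * N * z : ℂ) ^ (1 / 2 : ℂ) = s at *
  generalize frickeConst N / tau ψ₀ = A₀ at *
  generalize frickeConst N / tau ψ₁ = A₁ at *
  have e₀ : A₀ * s = 1 := mul_right_cancel₀ (hθ₀ z) (by rw [one_mul]; exact h₀.symm)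
  have e₁ : A₁ * s ^ 3 = 1 := mul_right_cancel₀ (hθ₁ z) (by rw [one_mul]; exact h₁.symm)
  have f₀ : A₀ ^ 2 * Complex.I = 1 := by
    rw [← hs]; linear_combination (A₀ * s + 1) * e₀
  have f₁ : A₁ ^ 2 * Complex.I ^ 3 = 1 := by
    rw [← hs]; linear_combination (A₁ * s ^ 3 + 1) * e₁
  refine mul_right_cancel₀ Complex.I_ne_zero ?_
  linear_combination f₀ - f₁ + A₁ ^ 2 * Complex.I * Complex.I_sq

theorem slashFricke_law {N₀ N₁ M : ℕ} [NeZero N₀] [NeZero N₁] [NeZero M]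
    {ψ₀ : DirichletCharacter ℂ N₀} {ψ₁ : DirichletCharacter ℂ N₁}
    (hreal₀ : IsRealChar ψ₀) (hreal₁ : IsRealChar ψ₁)
    (hprim₀ : ψ₀.IsPrimitive) (hprim₁ : ψ₁.IsPrimitive) (heven : ψ₀.Even) (hodd : ψ₁.Odd)
    (hθ₀ : ∀ z : ℍ, theta0 ψ₀ z ≠ 0) (hθ₁ : ∀ z : ℍ, theta1 ψ₁ z ≠ 0)
    (a : ℤ) {k : ℝ} (m : ℕ) (hk : (m : ℝ) = k - 3 / 2) {f : ℍ → ℂ} (hf : IsSmooth f)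
    (hM : M = 4 * N₀ ^ 2) (hN : N₀ = N₁) (z : ℍ) :
    delta ψ₀ ψ₁ m a (slashFricke (2 - k) f M) z =
      -(tau ψ₀ / tau ψ₁) * slashFricke k (delta ψ₀ ψ₁ m a f) M z := by
  subst hN
  have hW : ∀ z : ℍ, ((frickeMatrix M • z : ℍ) : ℂ) = -1 / (4 * N₀ ^ 2 * z) := fun z => by
    rw [coe_frickeMatrix_smul, hM]; push_cast; rfl
  have hs : ∀ z : ℍ, (2 * N₀ * z : ℂ) ^ (1 / 2 : ℂ) = sqrtAut (frickeMatrix M) z := fun z => by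
    rw [sqrtAut, autFactor_frickeMatrix, hM, sqrt_four_mul_sq]; push_cast; rfl
  have h₀ := fun z => theta0_fricke hprim₀ hreal₀ heven (hW z)
  have h₁ := fun z => theta1_fricke hprim₁ hreal₁ hodd (hW z)
  simp only [hs] at h₀ h₁
  have key := delta_slash (isSmooth_theta0 hprim₀ heven) (isSmooth_theta1 hodd) hθ₀ hθ₁ h₀ h₁
    m a hk hf 1 z
  -- The quotient is `τ(ψ₁) / τ(ψ₀)`; the relation `τ(ψ₁)² = -τ(ψ₀)²` inverts it up to sign.
  have hA : frickeConst N₀ / tau ψ₀ / (frickeConst N₀ / tau ψ₁) = -(tau ψ₀ / tau ψ₁) := by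
    have hτ₀ := tau_ne_zero hprim₀
    have hτ₁ := tau_ne_zero hprim₁
    have hsq := theta_fricke_const_sq hprim₀ hreal₀ heven hprim₁ hreal₁ hodd hθ₀ hθ₁
    have hC : frickeConst N₀ ≠ 0 := by
      simp [frickeConst, Complex.cpow_eq_zero_iff, NeZero.ne N₀]
    rw [div_pow, div_pow, neg_div', div_eq_div_iff (pow_ne_zero 2 hτ₀) (pow_ne_zero 2 hτ₁)] at hsq
    have h2 : tau ψ₁ ^ 2 = -tau ψ₀ ^ 2 :=
      mul_left_cancel₀ (pow_ne_zero 2 hC) (by linear_combination hsq)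
    field_simp
    linear_combination h2
  have e1 : slashFricke (2 - k) f M = fun z =>
      1 * autFactor (frickeMatrix M) z ^ (-((2 - k : ℝ) : ℂ)) * f (frickeMatrix M • z) := by
    ext z; rw [slashFricke, autFactor_frickeMatrix]; ring
  rw [e1, key, hA, slashFricke, autFactor_frickeMatrix]
  ring

/-! ### The half-integral slash action -/

/-- Both exponents are integers, `1 - 2m` and `2m + 3`. They differ by 2 modulo 4, while `ε_d⁴ = 1`
and `ε_d² = (-1 / d)`. -/
theorem epsilon_cpow {k : ℝ} {m : ℕ} (hk : (m : ℝ) = k - 3 / 2) {d : ℤ} (hd : Odd d) :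
    epsilon d ^ (2 * ((2 - k : ℝ) : ℂ)) = kroneckerSym (-1) d * epsilon d ^ (2 * (k : ℂ)) := by
  obtain rfl : k = m + 3 / 2 := by linarith
  have h0 := epsilon_ne_zero d
  rw [← epsilon_sq hd]
  have e1 : epsilon d ^ (2 * ((2 - (m + 3 / 2) : ℝ) : ℂ)) = epsilon d ^ (1 - 2 * (m : ℤ)) := by
    rw [← Complex.cpow_intCast]; congr 1; push_cast; ring
  have e2 : epsilon d ^ (2 * ((m + 3 / 2 : ℝ) : ℂ)) = epsilon d ^ (2 * (m : ℤ) + 3) := by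
    rw [← Complex.cpow_intCast]; congr 1; push_cast; ring
  have h4 : (epsilon d ^ 4) ^ (m + 1) = 1 := by rw [epsilon_pow_four, one_pow]
  rw [e1, e2, ← mul_left_inj' (zpow_ne_zero (2 * (m : ℤ) + 3) h0), ← zpow_add₀ h0,
    show 1 - 2 * (m : ℤ) + (2 * m + 3) = (4 : ℕ) by push_cast; ring,
    show 2 * (m : ℤ) + 3 = (2 * m + 3 : ℕ) by push_cast; ring, zpow_natCast, zpow_natCast]
  linear_combination -epsilon d ^ 4 * h4

theorem slashHalf_law {N₀ N₁ : ℕ} [NeZero N₀] [NeZero N₁]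
    {ψ₀ : DirichletCharacter ℂ N₀} {ψ₁ : DirichletCharacter ℂ N₁}
    (hreal₀ : IsRealChar ψ₀) (hreal₁ : IsRealChar ψ₁)
    (hprim₀ : ψ₀.IsPrimitive) (hprim₁ : ψ₁.IsPrimitive) (heven : ψ₀.Even) (hodd : ψ₁.Odd)
    (hθ₀ : ∀ z : ℍ, theta0 ψ₀ z ≠ 0) (hθ₁ : ∀ z : ℍ, theta1 ψ₁ z ≠ 0)
    (a : ℤ) {k : ℝ} (m : ℕ) (hk : (m : ℝ) = k - 3 / 2) {f : ℍ → ℂ} (hf : IsSmooth f)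
    {γ : SL(2, ℤ)} (hγ₀ : (4 * N₀ ^ 2 : ℤ) ∣ γ 1 0) (hγ₁ : (4 * N₁ ^ 2 : ℤ) ∣ γ 1 0) (z : ℍ) :
    delta ψ₀ ψ₁ m a (slashHalf (2 - k) f γ) z =
      (kroneckerSym (-1) (γ 1 1) : ℂ) *
        (ψ₀ (γ 1 1 : ZMod N₀) / ψ₁ (γ 1 1 : ZMod N₁)) *
        slashHalf k (delta ψ₀ ψ₁ m a f) γ z := by
  set γ' : SL(2, ℝ) := γ.map (Int.castRingHom ℝ) with hγ'
  have hent : ∀ i j, γ' i j = γ i j := fun i j => rfl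
  have hdet : γ 0 0 * γ 1 1 - γ 0 1 * γ 1 0 = 1 := by
    have := γ.det_coe
    rwa [Matrix.det_fin_two] at this
  have hsmul : ∀ z : ℍ, γ • z = γ' • z := fun z => by
    ext
    rw [UpperHalfPlane.coe_specialLinearGroup_apply, UpperHalfPlane.coe_specialLinearGroup_apply]
    simp [hent]
  have haut : ∀ z : ℍ, (γ 1 0 : ℂ) * z + γ 1 1 = autFactor γ' z := fun z => by
    simp [autFactor, hent]
  have h₀ := theta0_smul hprim₀ hreal₀ heven (hent 0 0) (hent 0 1) (hent 1 0) (hent 1 1) hdet hγ₀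
  have h₁ := theta1_smul hprim₁ hreal₁ hodd (hent 0 0) (hent 0 1) (hent 1 0) (hent 1 1) hdet hγ₁
  have hd : Odd (γ 1 1) := by
    by_contra hd
    rw [Int.not_odd_iff_even] at hd
    obtain ⟨x, hx⟩ := hd
    obtain ⟨y, hy⟩ := hγ₀
    rw [hx, hy] at hdet
    have : 2 * (γ 0 0 * x - 2 * (γ 0 1 * N₀ ^ 2 * y)) = 1 := by linear_combination hdet
    omega
  have key := delta_slash (isSmooth_theta0 hprim₀ heven) (isSmooth_theta1 hodd) hθ₀ hθ₁ h₀ h₁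
    m a hk hf (kroneckerSym (γ 1 0) (γ 1 1) * epsilon (γ 1 1) ^ (2 * ((2 - k : ℝ) : ℂ))) z
  have hA₀ : ψ₀ (γ 1 1 : ZMod N₀) * thetaMult (γ 1 0) (γ 1 1) ≠ 0 := fun h =>
    hθ₀ (γ' • z) (by rw [h₀, h]; simp)
  have e1 : slashHalf (2 - k) f γ = fun z =>
      kroneckerSym (γ 1 0) (γ 1 1) * epsilon (γ 1 1) ^ (2 * ((2 - k : ℝ) : ℂ)) *
        autFactor γ' z ^ (-((2 - k : ℝ) : ℂ)) * f (γ' • z) := by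
    ext z; rw [slashHalf, haut, hsmul]
  -- The common multiplier `thetaMult` of both thetas cancels in `A₀ / A₁`, leaving `ψ₀(d) / ψ₁(d)`.
  rw [e1, key, slashHalf, haut, hsmul, epsilon_cpow hk hd,
    mul_div_mul_right _ _ (right_ne_zero_of_mul hA₀)]
  ring

theorem char_ne_zero_of_det {N : ℕ} (ψ : DirichletCharacter ℂ N) {a b c d : ℤ}
    (hdet : a * d - b * c = 1) (h : (N : ℤ) ∣ c) : ψ (d : ZMod N) ≠ 0 := by
  have h1 := congrArg (Int.cast : ℤ → ZMod N) hdet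
  push_cast at h1
  rw [(ZMod.intCast_zmod_eq_zero_iff_dvd c N).mpr h, mul_zero, sub_zero, mul_comm] at h1
  exact ((IsUnit.of_mul_eq_one _ h1).map ψ).ne_zero

end

end HalfBol

theorem mainTheorem1
    (N₀ N₁ : ℕ) [NeZero N₀] [NeZero N₁]
    (ψ₀ : DirichletCharacter ℂ N₀) (ψ₁ : DirichletCharacter ℂ N₁)
    (hreal₀ : HalfBol.IsRealChar ψ₀) (hreal₁ : HalfBol.IsRealChar ψ₁)
    (hprim₀ : ψ₀.IsPrimitive) (hprim₁ : ψ₁.IsPrimitive)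
    (heven : ψ₀.Even) (hodd : ψ₁.Odd)
    (hθ₀ : ∀ z : ℍ, HalfBol.theta0 ψ₀ z ≠ 0) (hθ₁ : ∀ z : ℍ, HalfBol.theta1 ψ₁ z ≠ 0)
    (a : ℤ) (k : ℝ) (m : ℕ) (hk : (m : ℝ) = k - 3 / 2)
    (N : ℕ) [NeZero N] (hN : N = Nat.lcm (4 * N₀ ^ 2) (4 * N₁ ^ 2))
    (f : ℍ → ℂ) (hf : HalfBol.IsSmooth f) :
    (∀ γ : SL(2, ℤ), γ ∈ CongruenceSubgroup.Gamma0 N →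
      ψ₁ (γ 1 1 : ZMod N₁) ≠ 0 ∧
      ∀ z : ℍ,
        HalfBol.delta ψ₀ ψ₁ m a (HalfBol.slashHalf (2 - k) f γ) z =
          (HalfBol.kroneckerSym (-1) (γ 1 1) : ℂ) *
            (ψ₀ (γ 1 1 : ZMod N₀) / ψ₁ (γ 1 1 : ZMod N₁)) *
            HalfBol.slashHalf k (HalfBol.delta ψ₀ ψ₁ m a f) γ z) ∧
    (N₀ = N₁ →
      N = 4 * N₀ ^ 2 ∧ HalfBol.tau ψ₁ ≠ 0 ∧
      ∀ z : ℍ,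
        HalfBol.delta ψ₀ ψ₁ m a (HalfBol.slashFricke (2 - k) f N) z =
          -(HalfBol.tau ψ₀ / HalfBol.tau ψ₁) *
            HalfBol.slashFricke k (HalfBol.delta ψ₀ ψ₁ m a f) N z) := by
  refine ⟨fun γ hγ => ?_, fun h => ?_⟩
  · have hc : (N : ℤ) ∣ γ 1 0 := by
      rw [CongruenceSubgroup.Gamma0_mem] at hγ
      exact (ZMod.intCast_zmod_eq_zero_iff_dvd _ N).mp hγ
    have h₀ : (4 * N₀ ^ 2 : ℤ) ∣ γ 1 0 := by
      refine Dvd.dvd.trans ?_ hc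
      rw [hN]; exact_mod_cast Nat.dvd_lcm_left _ _
    have h₁ : (4 * N₁ ^ 2 : ℤ) ∣ γ 1 0 := by
      refine Dvd.dvd.trans ?_ hc
      rw [hN]; exact_mod_cast Nat.dvd_lcm_right _ _
    have hdet : γ 0 0 * γ 1 1 - γ 0 1 * γ 1 0 = 1 := by
      have := γ.det_coe
      rwa [Matrix.det_fin_two] at this
    exact ⟨HalfBol.char_ne_zero_of_det ψ₁ hdet (Dvd.dvd.trans ⟨4 * N₁, by ring⟩ h₁),
      HalfBol.slashHalf_law hreal₀ hreal₁ hprim₀ hprim₁ heven hodd hθ₀ hθ₁ a m hk hf h₀ h₁⟩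
  · have hM : N = 4 * N₀ ^ 2 := by rw [hN, ← h, Nat.lcm_self]
    exact ⟨hM, HalfBol.tau_ne_zero hprim₁, HalfBol.slashFricke_law hreal₀ hreal₁ hprim₀ hprim₁
      heven hodd hθ₀ hθ₁ a m hk hf hM h⟩
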